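/- Let $k$ be an algebraically closed field of characteristic $0$, and let $a\ge 1$ and $1\le m<n$ be integers with $\gcd(m,n)=1$. Let $\mathbb P(1,m,n)$ be the weighted projective plane over $k$ with homogeneous coordinates $x_0,x_1,x_2$ of degrees $1,m,n$, and let $C\subset\mathbb P(1,m,n)$ be the curve $x_0^{amn}+x_1^{an}=x_2^{am}$. Let $\varphi:C\to\mathbb P(1,m)\cong\mathbb P^1$ be the morphism $[x_0,x_1,x_2]\mapsto[x_0,x_1]$. For a point $P$ of $C$ at which $\mathcal O_{C,P}$ is a discrete valuation ring, the ramification index is $e_P=v_P(t)$, where $t$ generates the maximal ideal of the local ring of $\mathbb P(1,m)$ at $\varphi(P)$. Let $R=\sum_P \operatorname{length}_{\mathcal O_{C,P}}\big((\Omega_{C/\mathbb P(1,m)})_P\big)\cdot P$ be the ramification divisor of $\varphi$, and let $R_0$ be its part supported on the line $x_0=0$. On $U_1=\{x_1\ne 0\}$ use the local coordinates $$z_j=\frac{x_0^{\,m\lceil jn/m\rceil-jn}\,x_2^{\,j}}{x_1^{\lceil jn/m\rceil}}\qquad(0\le j\le m),$$ with the convention $\lceil 0\rceil=1$. Then the points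 of $C$ with $x_0=0$ all lie in $U_1$, and they are exactly $a$ distinct points $P_1,\dots,P_a$, with local coordinates $(z_0,\dots,z_m)(P_j)=(0,\dots,0,\gamma_j)$, where $\gamma_1,\dots,\gamma_a$ are the $a$ distinct $a$-th roots of $1$ in $k$. At each $P_j$ the ring $\mathcal O_{C,P_j}$ is a discrete valuation ring and $\varphi$ has ramification index $e_{P_j}=m$ (so $P_j$ is a ramification point if $m\ge 2$). Moreover $$R_0=\sum_{j=1}^a (m-1)\cdot P_j ,\qquad \deg R_0=a(m-1).$$ -/

import Mathlib

noncomputable section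

namespace WProj

open MvPolynomial

variable {σ : Type} {k : Type*} [Field k]

/-- Nonzero vectors of `k ^ σ`: homogeneous coordinates on a weighted projective space. -/
abbrev Coords (k : Type*) [Field k] (σ : Type) : Type _ := {x : σ → k // x ≠ 0}

/-- Two coordinate vectors are equivalent when `y i = t ^ (w i) * x i` for some `t ∈ kˣ`. -/
def rel (k : Type*) [Field k] (w : σ → ℕ) : Setoid (Coords k σ) where
  r x y := ∃ t : kˣ, ∀ i, y.1 i = (t : k) ^ w i * x.1 i
  iseqv :=
    { refl := fun x => ⟨1, fun i => by simp⟩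
      symm := by
        rintro x y ⟨t, h⟩
        refine ⟨t⁻¹, fun i => ?_⟩
        rw [h i, ← mul_assoc, ← mul_pow]
        simp
      trans := by
        rintro x y z ⟨t, h⟩ ⟨s, h'⟩
        refine ⟨s * t, fun i => ?_⟩
        rw [h' i, h i, Units.val_mul, mul_pow, mul_assoc] }

/-- The points of the weighted projective space `ℙ(w)` over `k`. -/
def Point (k : Type*) [Field k] (w : σ → ℕ) : Type _ := Quotient (rel k w)

/-- The point `[x]` with homogeneous coordinates `x`. -/
def mk {w : σ → ℕ} (x : Coords k σ) : Point k w := Quotient.mk (rel k w) x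

theorem mk_eq_mk {w : σ → ℕ} {x y : Coords k σ} :
    (mk x : Point k w) = mk y ↔ ∃ t : kˣ, ∀ i, y.1 i = (t : k) ^ w i * x.1 i :=
  Quotient.eq (r := rel k w)

theorem exists_rep {w : σ → ℕ} (P : Point k w) : ∃ x : Coords k σ, mk x = P :=
  Quotient.exists_rep P

theorem eval_smul {w : σ → ℕ} {d : ℕ} {f : MvPolynomial σ k} (hf : f.IsWeightedHomogeneous w d)
    (t : k) (x : σ → k) :
    eval (fun i => t ^ w i * x i) f = t ^ d * eval x f := by
  rw [eval_eq, eval_eq, Finset.mul_sum]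
  refine Finset.sum_congr rfl fun s hs => ?_
  have h := hf (mem_support_iff.mp hs)
  simp only [mul_pow, Finset.prod_mul_distrib]
  rw [← h, Finsupp.weight_apply, Finsupp.sum, ← Finset.prod_pow_eq_pow_sum]
  have : ∏ i ∈ s.support, (t ^ w i) ^ s i = ∏ i ∈ s.support, t ^ (s i • w i) :=
    Finset.prod_congr rfl fun i _ => by rw [← pow_mul, smul_eq_mul, mul_comm]
  rw [this]
  ring

/-- The homogeneous coordinate ring, graded by `deg X_i = w i`. -/
abbrev grading (k : Type*) [Field k] (w : σ → ℕ) : ℕ → Submodule k (MvPolynomial σ k) :=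
  weightedHomogeneousSubmodule k w

instance gradedAlgebra (w : σ → ℕ) : GradedAlgebra (grading k w) :=
  weightedGradedAlgebra k w

/-- Polynomials vanishing at none of the coordinate vectors of `P`. A homogeneous polynomial lies
here as soon as it does not vanish at one of them. -/
def nonvanishing {w : σ → ℕ} (P : Point k w) : Submonoid (MvPolynomial σ k) where
  carrier := {g | ∀ x : Coords k σ, mk x = P → eval x.1 g ≠ 0}
  one_mem' := fun x _ => by simp
  mul_mem' := fun hf hg x hx => by
    rw [map_mul]
    exact mul_ne_zero (hf x hx) (hg x hx)

theorem mem_nonvanishing {w : σ → ℕ} {d : ℕ} {g : MvPolynomial σ k}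
    (hg : g.IsWeightedHomogeneous w d) (x : Coords k σ) (h : eval x.1 g ≠ 0) :
    g ∈ nonvanishing (mk x : Point k w) := by
  intro y hy
  obtain ⟨t, ht⟩ := mk_eq_mk.mp hy.symm
  have : y.1 = fun i => (t : k) ^ w i * x.1 i := funext ht
  rw [this, eval_smul hg]
  exact mul_ne_zero (pow_ne_zero _ t.ne_zero) h

/-- The local ring of `ℙ(w)` at `P`: fractions `f / g` with `f`, `g` homogeneous of the same degree
and `g(P) ≠ 0`. -/
abbrev LocalRing {w : σ → ℕ} (P : Point k w) : Type _ :=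
  HomogeneousLocalization (grading k w) (nonvanishing P)

/-- The value at `P = [x]` of the elements of the local ring at `P`. -/
def valueAt {w : σ → ℕ} (x : Coords k σ) : LocalRing (mk x : Point k w) →+* k :=
  (IsLocalization.lift (M := nonvanishing (mk x : Point k w))
    (S := Localization (nonvanishing (mk x : Point k w))) (g := eval x.1)
    (fun g => isUnit_iff_ne_zero.mpr (g.2 x rfl))).comp
  (algebraMap (LocalRing (mk x : Point k w)) (Localization (nonvanishing (mk x : Point k w))))

theorem valueAt_mk {w : σ → ℕ} (x : Coords k σ)
    (c : HomogeneousLocalization.NumDenSameDeg (grading k w) (nonvanishing (mk x : Point k w))) :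
    valueAt x (HomogeneousLocalization.mk c) =
      eval x.1 (c.num : MvPolynomial σ k) / eval x.1 (c.den : MvPolynomial σ k) := by
  have h0 : eval x.1 (c.den : MvPolynomial σ k) ≠ 0 := c.den_mem x rfl
  simp only [valueAt, RingHom.comp_apply, HomogeneousLocalization.algebraMap_apply,
    HomogeneousLocalization.val_mk, Localization.mk_eq_mk', IsLocalization.lift_mk'_spec]
  field_simp

instance isLocalHom_valueAt {w : σ → ℕ} (x : Coords k σ) :
    IsLocalHom (valueAt x : LocalRing (mk x : Point k w) →+* k) where
  map_nonunit q hq := by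
    obtain ⟨c, rfl⟩ := HomogeneousLocalization.mk_surjective q
    rw [valueAt_mk, isUnit_iff_ne_zero, div_ne_zero_iff] at hq
    let c' : HomogeneousLocalization.NumDenSameDeg (grading k w)
        (nonvanishing (mk x : Point k w)) :=
      ⟨c.deg, c.den, c.num, mem_nonvanishing c.num.2 x hq.1⟩
    refine IsUnit.of_mul_eq_one (HomogeneousLocalization.mk c') ?_
    apply HomogeneousLocalization.val_injective
    rw [HomogeneousLocalization.val_mul, HomogeneousLocalization.val_mk,
      HomogeneousLocalization.val_mk, HomogeneousLocalization.val_one, Localization.mk_mul,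
      ← Localization.mk_one, Localization.mk_eq_mk_iff, Localization.r_iff_exists]
    exact ⟨1, by simp [c', mul_comm]⟩

instance isLocalRing {w : σ → ℕ} (P : Point k w) : IsLocalRing (LocalRing P) := by
  obtain ⟨x, rfl⟩ := exists_rep P
  exact (valueAt x).domain_isLocalRing

end WProj

namespace FermatType

open MvPolynomial

/-- The weighted projective plane `ℙ(1, m, n)`. -/
abbrev Plane (k : Type*) [Field k] (m n : ℕ) : Type _ := WProj.Point k ![1, m, n]

/-- The weighted projective line `ℙ(1, m)`. -/
abbrev Line (k : Type*) [Field k] (m : ℕ) : Type _ := WProj.Point k ![1, m]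

/-- The weighted homogeneous polynomial `x₀ ^ (amn) + x₁ ^ (an) - x₂ ^ (am)`. -/
def poly (k : Type*) [Field k] (a m n : ℕ) : MvPolynomial (Fin 3) k :=
  X 0 ^ (a * m * n) + X 1 ^ (a * n) - X 2 ^ (a * m)

/-- The points of the Fermat-type curve `C` in `ℙ(1, m, n)`. -/
def Curve (k : Type*) [Field k] (a m n : ℕ) : Type _ :=
  {P : Plane k m n // ∀ x, WProj.mk x = P → eval x.1 (poly k a m n) = 0}

variable {k : Type*} [Field k] {a m n : ℕ}

theorem poly_isWeightedHomogeneous :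
    (poly k a m n).IsWeightedHomogeneous ![1, m, n] (a * m * n) := by
  have h (i : Fin 3) (e : ℕ) (he : e * (![1, m, n] : Fin 3 → ℕ) i = a * m * n) :
      ((X i : MvPolynomial (Fin 3) k) ^ e).IsWeightedHomogeneous ![1, m, n] (a * m * n) := by
    have := (isWeightedHomogeneous_X k ![1, m, n] i).pow e
    rwa [smul_eq_mul, he] at this
  have h0 := h 0 (a * m * n) (by simp)
  have h1 := h 1 (a * n) (by simp; ring)
  have h2 := h 2 (a * m) (by simp)
  exact (weightedHomogeneousSubmodule k ![1, m, n] (a * m * n)).sub_mem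
    ((weightedHomogeneousSubmodule k ![1, m, n] (a * m * n)).add_mem h0 h1) h2

/-- Membership in `C` may be tested on one coordinate vector. -/
theorem mem_curve_iff (x : WProj.Coords k (Fin 3)) :
    (∀ y, (WProj.mk y : Plane k m n) = WProj.mk x → eval y.1 (poly k a m n) = 0) ↔
      x.1 0 ^ (a * m * n) + x.1 1 ^ (a * n) = x.1 2 ^ (a * m) := by
  have hx : eval x.1 (poly k a m n) = 0 ↔
      x.1 0 ^ (a * m * n) + x.1 1 ^ (a * n) = x.1 2 ^ (a * m) := by
    simp [poly, sub_eq_zero]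
  rw [← hx]
  refine ⟨fun h => h x rfl, fun h y hy => ?_⟩
  obtain ⟨t, ht⟩ := WProj.mk_eq_mk.mp hy.symm
  have : y.1 = fun i => (t : k) ^ (![1, m, n] : Fin 3 → ℕ) i * x.1 i := funext ht
  rw [this, WProj.eval_smul poly_isWeightedHomogeneous, h, mul_zero]

/-- The germs at `P` of functions on `ℙ(1, m, n)` that lie in the ideal of `C`, that is,
the fractions in the local ring that are multiples of the equation of `C`. -/
def idealAt (P : Curve k a m n) : Ideal (WProj.LocalRing P.1) :=
  ((Ideal.span {poly k a m n}).map
    (algebraMap (MvPolynomial (Fin 3) k) (Localization (WProj.nonvanishing P.1)))).comap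
  (algebraMap (WProj.LocalRing P.1) (Localization (WProj.nonvanishing P.1)))

/-- The local ring `𝒪_{C, P}`. -/
abbrev LocalRing (P : Curve k a m n) : Type _ := WProj.LocalRing P.1 ⧸ idealAt P

theorem idealAt_ne_top (P : Curve k a m n) : idealAt P ≠ ⊤ := by
  obtain ⟨P, hP⟩ := P
  obtain ⟨x, rfl⟩ := WProj.exists_rep P
  unfold idealAt
  rw [Ne, Ideal.comap_eq_top_iff, Ideal.map_span, Set.image_singleton,
    Ideal.span_singleton_eq_top]
  intro h
  have := h.map (IsLocalization.lift (M := WProj.nonvanishing (WProj.mk x : Plane k m n))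
    (S := Localization (WProj.nonvanishing (WProj.mk x : Plane k m n))) (g := eval x.1)
    (fun g => isUnit_iff_ne_zero.mpr (g.2 x rfl)))
  rw [IsLocalization.lift_eq, hP x rfl] at this
  exact not_isUnit_zero this

instance isLocalRing (P : Curve k a m n) : IsLocalRing (LocalRing P) :=
  haveI : Nontrivial (LocalRing P) := Ideal.Quotient.nontrivial_iff.mpr (idealAt_ne_top P)
  IsLocalRing.of_surjective' (Ideal.Quotient.mk (idealAt P)) Ideal.Quotient.mk_surjective

/-- The first two coordinates of a coordinate vector. -/
abbrev firstTwo (x : Fin 3 → k) : Fin 2 → k := fun i => x i.castSucc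

section Projection

variable [NeZero a] [NeZero m] [NeZero n]

theorem firstTwo_ne_zero (P : Curve k a m n) (x : WProj.Coords k (Fin 3)) (hx : WProj.mk x = P.1) :
    firstTwo x.1 ≠ 0 := by
  intro h
  have h0 : x.1 0 = 0 := congrFun h 0
  have h1 : x.1 1 = 0 := congrFun h 1
  have hP := P.2 x hx
  have ha := NeZero.ne a
  have hm := NeZero.ne m
  have hn := NeZero.ne n
  simp only [poly, map_sub, map_add, map_pow, eval_X, h0, h1] at hP
  rw [zero_pow (by positivity), zero_pow (by positivity)] at hP
  have h2 : x.1 2 = 0 := by simpa [ha, hm] using hP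
  refine x.2 (funext fun i => ?_)
  fin_cases i
  · exact h0
  · exact h1
  · exact h2

/-- The morphism `φ : C → ℙ(1, m)`, `[x₀, x₁, x₂] ↦ [x₀, x₁]`, on points. -/
def phi (P : Curve k a m n) : Line k m :=
  WProj.mk ⟨firstTwo (WProj.exists_rep P.1).choose.1,
    firstTwo_ne_zero P _ (WProj.exists_rep P.1).choose_spec⟩

/-- `φ` is computed by any coordinate vector. -/
theorem phi_eq (P : Curve k a m n) (x : WProj.Coords k (Fin 3)) (hx : WProj.mk x = P.1) :
    phi P = WProj.mk ⟨firstTwo x.1, firstTwo_ne_zero P x hx⟩ := by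
  have h := (WProj.exists_rep P.1).choose_spec
  obtain ⟨t, ht⟩ := WProj.mk_eq_mk.mp (h.trans hx.symm)
  refine WProj.mk_eq_mk.mpr ⟨t, fun i => ?_⟩
  have := ht i.castSucc
  fin_cases i <;> exact this

/-- The inclusion `k[x₀, x₁] → k[x₀, x₁, x₂]` of graded rings. -/
def inclusion (k : Type*) [Field k] (m n : ℕ) :
    GradedRingHom (WProj.grading k ![1, m]) (WProj.grading k ![1, m, n]) where
  toRingHom := (rename Fin.castSucc : MvPolynomial (Fin 2) k →ₐ[k] MvPolynomial (Fin 3) k).toRingHom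
  map_mem := by
    intro d f hf
    rw [mem_weightedHomogeneousSubmodule] at hf ⊢
    have hw : ((![1, m, n] : Fin 3 → ℕ) ∘ Fin.castSucc) = ![1, m] := by
      funext i
      fin_cases i <;> rfl
    intro c hc
    obtain ⟨u, rfl, hu⟩ := coeff_rename_ne_zero _ _ _ hc
    rw [← hf hu, ← hw, Finsupp.weight_apply, Finsupp.weight_apply,
      Finsupp.sum_mapDomain_index (by simp) (fun _ _ _ => by simp [add_mul])]
    rfl

theorem nonvanishing_le (P : Curve k a m n) :
    WProj.nonvanishing (phi P) ≤ (WProj.nonvanishing P.1).comap (inclusion k m n) := by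
  intro g hg x hx
  have := hg _ (phi_eq P x hx).symm
  change eval x.1 (rename Fin.castSucc g) ≠ 0
  rw [eval_rename]
  exact this

/-- The pull-back of germs of functions `φ^* : 𝒪_{ℙ(1, m), φ(P)} → 𝒪_{C, P}`. -/
def pullback (P : Curve k a m n) : WProj.LocalRing (phi P) →+* LocalRing P :=
  (Ideal.Quotient.mk (idealAt P)).comp
    (HomogeneousLocalization.map (inclusion k m n) (nonvanishing_le P))

instance algebraPullback (P : Curve k a m n) : Algebra (WProj.LocalRing (phi P)) (LocalRing P) :=
  (pullback P).toAlgebra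

/-- The ramification index `e_P = v_P(t)` of `φ` at `P`, `t` a generator of the maximal ideal at
`φ(P)`: the largest `e` with `φ^*(𝔪_{φ(P)}) ⊆ 𝔪_P ^ e`. -/
def ramificationIndex (P : Curve k a m n) : ℕ :=
  Ideal.ramificationIdx' (IsLocalRing.maximalIdeal (WProj.LocalRing (phi P)))
    (IsLocalRing.maximalIdeal (LocalRing P))

/-- `P` is a ramification point of `φ`. -/
def IsRamificationPoint (P : Curve k a m n) : Prop := 1 < ramificationIndex P

/-- The ramification divisor `R = ∑_P length((Ω_{C / ℙ(1, m)})_P) · P` of `φ`. -/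
def ramificationDivisor (P : Curve k a m n) : ℕ∞ :=
  Module.length (LocalRing P) (Ω[LocalRing P ⁄ WProj.LocalRing (phi P)])

end Projection

/-- The points of `C` on the line `x₀ = 0`. -/
def onLine (k : Type*) [Field k] (a m n : ℕ) : Set (Curve k a m n) :=
  {P | ∀ x, WProj.mk x = P.1 → x.1 0 = 0}

/-- The part `R₀` of the ramification divisor of `φ` on the line `x₀ = 0`. -/
def ramificationDivisorOnLine [NeZero a] [NeZero m] [NeZero n] : Curve k a m n → ℕ∞ :=
  (onLine k a m n).indicator ramificationDivisor

/-- `⌈j n / m⌉`, with the convention `⌈0⌉ = 1`. -/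
def ceilDiv' (m n j : ℕ) : ℕ := if j = 0 then 1 else ⌈((j * n : ℕ) : ℚ) / (m : ℚ)⌉₊

/-- `P` lies in `U₁ = {x₁ ≠ 0}` and its local coordinates
`z_j = x₀ ^ (m ⌈j n / m⌉ - j n) x₂ ^ j / x₁ ^ ⌈j n / m⌉`, `0 ≤ j ≤ m`, are `z`. -/
def HasLocalCoords (P : Plane k m n) (z : Fin (m + 1) → k) : Prop :=
  ∀ x, WProj.mk x = P → x.1 1 ≠ 0 ∧ ∀ j : Fin (m + 1),
    z j = x.1 0 ^ (m * ceilDiv' m n j - j * n) * x.1 2 ^ (j : ℕ) / x.1 1 ^ ceilDiv' m n j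

end FermatType

end

/-! Near `x₀ = 0` everything is computed in torus coordinates. With `n v = 1 + m u`, the fractions
`S = x₀ x₁^u / x₂^v` and `W = x₁^n / x₂^m` have degree zero, and `l = x₂^v / x₁^u` has degree one;
then `x₀ = l S`, `x₁ = l^m W^v`, `x₂ = l^n W^u`. Powers of `l` cancel in fractions of degree zero,
so every germ is a quotient of polynomials in `S`, `W`, and the curve becomes `S^(amn) = W^(uam) (1
- W^a)` (`torus_chart`, `torus_equation`).

Let `B` be the local ring of `C` and `A` that of the line. In characteristic zero `1 - W^a` has
simple roots, so `S` generates the maximal ideal of `B`. The expansion `x₀ = X`, `x₁ = 1`, `x₂ = (1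
+ X^(amn))^(1/(am))` shows that `S` is not nilpotent; hence `B` is a discrete valuation ring. The
parameter `t = x₀^m / x₁` of `A` satisfies `t W^v = S^m`, so the index is `m`.

Differentiating the equation shows that `dS` generates `Ω[B⁄A]`, and `dt = 0` gives `S^(m-1) dS =
0`. Conversely, `t` expands to `X^m`, so `d/dX` sends the image of `A` into `(X^(m-1))` and no
smaller power of `S` kills `dS`. Thus `Ω[B⁄A]` is `B / (S^(m-1))`. `TameRamification.Chart` isolates
the data for this argument; `exists_chart` supplies them.

The points on `x₀ = 0` are the `[0, 1, ω]` with `ω^(am) = 1`; by coprimality such a point depends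
only on `ω^m`, an `a`-th root of unity. -/

/-! ### Local rings with principal maximal ideal -/

theorem isNoetherianRing_of_fractions {R B : Type*} [CommRing R] [CommRing B] [IsNoetherianRing R]
    (φ : R →+* B) (h : ∀ b : B, ∃ f g : R, IsUnit (φ g) ∧ b * φ g = φ f) : IsNoetherianRing B := by
  refine (isNoetherianRing_iff_ideal_fg B).mpr fun I => ?_
  -- As for localizations, every ideal is extended from its contraction: up to a unit, `b` is the
  -- image of its numerator.
  have : I = (I.comap φ).map φ := by
    refine le_antisymm (fun b hb => ?_) Ideal.map_comap_le
    obtain ⟨f, g, hg, hbg⟩ := h b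
    have hf : f ∈ I.comap φ := by
      rw [Ideal.mem_comap, ← hbg]
      exact I.mul_mem_right _ hb
    have := Ideal.mem_map_of_mem φ hf
    rw [← hbg] at this
    exact (Ideal.mul_unit_mem_iff_mem _ hg).mp this
  rw [this]
  exact ((isNoetherianRing_iff_ideal_fg R).mp inferInstance _).map φ

namespace IsLocalRing

variable {B : Type*} [CommRing B] [IsLocalRing B] {s : B}

/-- Krull's intersection theorem bounds the powers of `s` dividing `b`; after the largest one, the
cofactor is a unit. -/
theorem exists_eq_pow_mul_isUnit [IsNoetherianRing B] (hs : maximalIdeal B = Ideal.span {s})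
    {b : B} (hb : b ≠ 0) : ∃ (n : ℕ) (u : B), IsUnit u ∧ b = s ^ n * u := by
  have hn : ∃ n, b ∉ Ideal.span {s} ^ n := by
    by_contra! h
    refine hb ?_
    rw [← Ideal.mem_bot, ← Ideal.iInf_pow_eq_bot_of_isLocalRing (maximalIdeal B) Ideal.IsPrime.ne_top',
      hs]
    exact (Submodule.mem_iInf _).mpr h
  classical
  have hspec := Nat.find_spec hn
  obtain ⟨n, hn'⟩ : ∃ n, Nat.find hn = n + 1 :=
    Nat.exists_eq_succ_of_ne_zero fun h0 => by rw [h0] at hspec; simp at hspec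
  have hmem : b ∈ Ideal.span {s} ^ n := not_not.mp (Nat.find_min hn (m := n) (by omega))
  rw [Ideal.span_singleton_pow, Ideal.mem_span_singleton] at hmem
  obtain ⟨u, rfl⟩ := hmem
  refine ⟨n, u, ?_, rfl⟩
  by_contra hu
  have hu' : u ∈ Ideal.span {s} := by rwa [← hs, mem_maximalIdeal]
  obtain ⟨v, rfl⟩ := Ideal.mem_span_singleton.mp hu'
  rw [hn', Ideal.span_singleton_pow, Ideal.mem_span_singleton] at hspec
  exact hspec ⟨v, by ring⟩

theorem isDomain_of_maximalIdeal_eq_span [IsNoetherianRing B]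
    (hs : maximalIdeal B = Ideal.span {s}) (hnil : ¬ IsNilpotent s) : IsDomain B := by
  have : NoZeroDivisors B := by
    refine ⟨fun {x y} hxy => ?_⟩
    by_contra! h
    obtain ⟨i, u, hu, rfl⟩ := exists_eq_pow_mul_isUnit hs h.1
    obtain ⟨j, v, hv, rfl⟩ := exists_eq_pow_mul_isUnit hs h.2
    refine hnil ⟨i + j, (hu.mul hv).mul_left_eq_zero.mp ?_⟩
    rw [← hxy]
    ring
  exact NoZeroDivisors.to_isDomain B

theorem isDiscreteValuationRing_of_maximalIdeal_eq_span [IsNoetherianRing B] [IsDomain B]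
    (hs : maximalIdeal B = Ideal.span {s}) (hnil : ¬ IsNilpotent s) :
    IsDiscreteValuationRing B := by
  have h0 : s ≠ 0 := fun h => hnil (h ▸ IsNilpotent.zero)
  refine IsDiscreteValuationRing.ofHasUnitMulPowIrreducibleFactorization
    ⟨s, IsDiscreteValuationRing.irreducible_of_span_eq_maximalIdeal s h0 hs, fun {x} hx => ?_⟩
  obtain ⟨n, u, hu, rfl⟩ := exists_eq_pow_mul_isUnit hs hx
  exact ⟨n, hu.unit, rfl⟩

end IsLocalRing

/-! ### Length of a cyclic module of differentials -/

namespace KaehlerDifferential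

open IsLocalRing

variable {A B : Type*} [CommRing A] [CommRing B] [Algebra A B]

/-- A derivation `δ` of `R` and `θ : B → R` such that `δ ∘ θ` maps `A` into an ideal `I` induce
a map `Ω[B⁄A] → R ⧸ I`; in particular `b • ds = 0` forces `θ b * δ (θ s) ∈ I`. -/
theorem mul_mem_of_smul_D_eq_zero {k R : Type*} [CommRing k] [CommRing R] [Algebra k R]
    (θ : B →+* R) (δ : Derivation k R R)
    (I : Ideal R) (hA : ∀ a, δ (θ (algebraMap A B a)) ∈ I) {b s : B}
    (h : b • D A B s = 0) : θ b * δ (θ s) ∈ I := by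
  let : Algebra B R := θ.toAlgebra
  let : Algebra A R := (θ.comp (algebraMap A B)).toAlgebra
  have : IsScalarTower A B R := IsScalarTower.of_algebraMap_eq fun _ => rfl
  have hsm (c : B) (r : R) : c • (Ideal.Quotient.mk I r) = Ideal.Quotient.mk I (θ c * r) := rfl
  have hsmA (c : A) (r : R) :
    c • (Ideal.Quotient.mk I r) = Ideal.Quotient.mk I (θ (algebraMap A B c) * r) := rfl
  let d : Derivation A B (R ⧸ I) := Derivation.mk'
    { toFun := fun c => Ideal.Quotient.mk I (δ (θ c))
      map_add' := fun x y => by simp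
      map_smul' := fun a x => by
        rw [RingHom.id_apply, hsmA, Algebra.smul_def, map_mul, Derivation.leibniz, map_add,
          smul_eq_mul, smul_eq_mul, add_eq_left, Ideal.Quotient.eq_zero_iff_mem]
        exact I.mul_mem_left _ (hA a) }
    (fun x y => by
      change Ideal.Quotient.mk I (δ (θ (x * y))) = _
      rw [map_mul, Derivation.leibniz, map_add]
      rfl)
  have := congrArg d.liftKaehlerDifferential h
  rw [map_smul, map_zero, Derivation.liftKaehlerDifferential_comp_D] at this
  change b • Ideal.Quotient.mk I (δ (θ s)) = 0 at this
  rwa [hsm, Ideal.Quotient.eq_zero_iff_mem] at this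

/-- The map `b ↦ b • ds` is onto by `hgen`. Its kernel contains `s ^ e` by `hann`, and is no larger
because the derivation `δ` detects `ds` modulo `I`. -/
theorem length_of_isDiscreteValuationRing [IsDomain B] [IsDiscreteValuationRing B] {s : B}
    (hs : maximalIdeal B = Ideal.span {s}) {k R : Type*} [CommRing k] [CommRing R]
    [Algebra k R] (θ : B →+* R) (δ : Derivation k R R) (e : ℕ) (I : Ideal R) (hA : ∀ a, δ (θ (algebraMap A B a)) ∈ I)
    (hδ : IsUnit (δ (θ s))) (hI : ∀ b, θ b ∈ I → s ^ e ∣ b)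
    (hgen : ∀ b, D A B b ∈ Submodule.span B {D A B s}) (hann : s ^ e • D A B s = 0) :
    Module.length B (Ω[B⁄A]) = e := by
  let f : B →ₗ[B] Ω[B⁄A] := LinearMap.toSpanSingleton B _ (D A B s)
  have hker : LinearMap.ker f = maximalIdeal B ^ e := by
    ext b
    rw [hs, Ideal.span_singleton_pow, Ideal.mem_span_singleton, LinearMap.mem_ker,
      LinearMap.toSpanSingleton_apply]
    constructor
    · intro h
      exact hI b ((Ideal.mul_unit_mem_iff_mem _ hδ).mp (mul_mem_of_smul_D_eq_zero θ δ I hA h))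
    · rintro ⟨c, rfl⟩
      rw [mul_comm, mul_smul, hann, smul_zero]
  have hrange : LinearMap.range f = ⊤ := by
    rw [← LinearMap.span_singleton_eq_range, eq_top_iff, ← span_range_derivation, Submodule.span_le]
    rintro _ ⟨b, rfl⟩
    exact hgen b
  rw [← IsDiscreteValuationRing.length_quotient_pow_maximalIdeal B e, ← hker]
  exact (f.quotKerEquivOfSurjective (LinearMap.range_eq_top.mp hrange)).length_eq.symm

end KaehlerDifferential

/-! ### Roots of power series -/

namespace PowerSeries

/-- Hensel's lemma for `Y ^ N - f` at `Y = c`, where the derivative `N c ^ (N - 1)` is invertible in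
characteristic zero. -/
theorem exists_pow_eq {k : Type*} [Field k] [CharZero k] {N : ℕ} (hN : N ≠ 0) (f : k⟦X⟧) {c : k}
    (hc : c ≠ 0) (hf : constantCoeff f = c ^ N) :
    ∃ g : k⟦X⟧, g ^ N = f ∧ constantCoeff g = c := by
  have hmem (h : k⟦X⟧) : h ∈ Ideal.span {(X : k⟦X⟧)} ↔ constantCoeff h = 0 := by
    rw [Ideal.mem_span_singleton, X_dvd_iff]
  obtain ⟨g, hg, hgc⟩ := HenselianRing.is_henselian (R := k⟦X⟧) (I := Ideal.span {X})
    (Polynomial.X ^ N - Polynomial.C f) (Polynomial.monic_X_pow_sub_C f hN) (C c)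
    (by simp [hmem, hf]) (by
      refine IsUnit.map _ ?_
      simp [isUnit_iff_constantCoeff, Polynomial.derivative_X_pow, hN, hc])
  refine ⟨g, by simpa [sub_eq_zero] using hg, ?_⟩
  simpa [hmem, sub_eq_zero] using hgc

end PowerSeries

/-! ### Germs on weighted projective spaces -/

noncomputable section

namespace WProj

open MvPolynomial

section General

variable {σ : Type} {k : Type*} [Field k] {w : σ → ℕ}

/-- Weighted homogeneity, for values in any commutative algebra. -/
theorem aeval_smul {R : Type*} [CommRing R] [Algebra k R] {d : ℕ} {f : MvPolynomial σ k}
    (hf : f.IsWeightedHomogeneous w d) (l : R) (y : σ → R) :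
    aeval (fun i => l ^ w i * y i) f = l ^ d * aeval y f := by
  rw [aeval_def, aeval_def, eval₂_eq, eval₂_eq, Finset.mul_sum]
  refine Finset.sum_congr rfl fun s hs => ?_
  have h := hf (mem_support_iff.mp hs)
  rw [← h, Finsupp.weight_apply, Finsupp.sum]
  simp only [mul_pow, Finset.prod_mul_distrib, ← pow_mul, smul_eq_mul,
    Finset.prod_pow_eq_pow_sum, mul_comm (w _)]
  ring

variable (P : Point k w)

instance algebraLocalRing : Algebra k (LocalRing P) where
  algebraMap := (algebraMap (grading k w 0) (LocalRing P)).comp (algebraMap k (grading k w 0))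
  commutes' _ _ := mul_comm _ _
  smul_def' c q := by
    apply HomogeneousLocalization.val_injective
    rw [HomogeneousLocalization.val_smul, HomogeneousLocalization.val_mul, Algebra.smul_def,
      IsScalarTower.algebraMap_apply k (MvPolynomial σ k)]
    rfl

/-- The inclusion of the local ring into the ring of all fractions, over `k`. -/
def valAlgHom : LocalRing P →ₐ[k] Localization (nonvanishing P) where
  __ := algebraMap (LocalRing P) (Localization (nonvanishing P))
  commutes' c := by
    rw [IsScalarTower.algebraMap_apply k (MvPolynomial σ k) (Localization (nonvanishing P))]
    rfl

theorem valAlgHom_injective : Function.Injective (valAlgHom P) :=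
  HomogeneousLocalization.val_injective _

/-- Evaluation at `P` extends to all fractions, so `q` has a nonzero value, and `valueAt` is a local
homomorphism. -/
theorem isUnit_of_valAlgHom {q : LocalRing P} (h : IsUnit (valAlgHom P q)) : IsUnit q := by
  obtain ⟨x, rfl⟩ := exists_rep P
  refine isUnit_of_map_unit (valueAt x) q ?_
  exact h.map (IsLocalization.lift (M := nonvanishing (mk x : Point k w))
    (S := Localization (nonvanishing (mk x : Point k w))) (g := eval x.1)
    (fun g => isUnit_iff_ne_zero.mpr (g.2 x rfl)))

variable {P}

/-- The fraction `f / g`. -/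
def frac {d : ℕ} {f g : MvPolynomial σ k} (hf : f.IsWeightedHomogeneous w d)
    (hg : g.IsWeightedHomogeneous w d) (hP : g ∈ nonvanishing P) : LocalRing P :=
  HomogeneousLocalization.mk ⟨d, ⟨f, hf⟩, ⟨g, hg⟩, hP⟩

theorem valAlgHom_frac {d : ℕ} {f g : MvPolynomial σ k} (hf : f.IsWeightedHomogeneous w d)
    (hg : g.IsWeightedHomogeneous w d) (hP : g ∈ nonvanishing P) :
    valAlgHom P (frac hf hg hP) * algebraMap _ _ g = algebraMap _ _ f := by
  change Localization.mk f ⟨g, hP⟩ * _ = _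
  rw [Localization.mk_eq_mk']
  exact IsLocalization.mk'_spec _ f (⟨g, hP⟩ : nonvanishing P)

theorem exists_eq_frac (q : LocalRing P) : ∃ (d : ℕ) (f g : MvPolynomial σ k)
    (hf : f.IsWeightedHomogeneous w d) (hg : g.IsWeightedHomogeneous w d)
    (hP : g ∈ nonvanishing P), q = frac hf hg hP := by
  obtain ⟨c, rfl⟩ := HomogeneousLocalization.mk_surjective q
  exact ⟨c.deg, c.num, c.den, c.num.2, c.den.2, c.den_mem, rfl⟩

theorem isUnit_algebraMap {g : MvPolynomial σ k} (hg : g ∈ nonvanishing P) :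
    IsUnit (algebraMap _ (Localization (nonvanishing P)) g) :=
  IsLocalization.map_units _ (⟨g, hg⟩ : nonvanishing P)

/-- If the coordinates are `l ^ w i * ψ (y i)` with `l` a unit of degree one, then all germs at `P`
are fractions of elements in the range of `ψ`. -/
theorem exists_fraction_of_chart {S : Type*} [CommRing S] [Algebra k S]
    (ψ : S →ₐ[k] LocalRing P) {l : Localization (nonvanishing P)} (hl : IsUnit l) (y : σ → S)
    (hy : ∀ i, algebraMap (MvPolynomial σ k) (Localization (nonvanishing P)) (X i) = l ^ w i * valAlgHom P (ψ (y i)))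
    (q : LocalRing P) : ∃ F G : S, IsUnit (ψ G) ∧ q * ψ G = ψ F := by
  obtain ⟨d, f, g, hf, hg, hP, rfl⟩ := exists_eq_frac q
  -- Numerator and denominator acquire the same factor `l ^ d`, which cancels.
  have key {h : MvPolynomial σ k} (hh : h.IsWeightedHomogeneous w d) :
      algebraMap _ (Localization (nonvanishing P)) h = l ^ d * valAlgHom P (ψ (aeval y h)) := by
    have h1 : (IsScalarTower.toAlgHom k (MvPolynomial σ k) (Localization (nonvanishing P))) =
        aeval (fun i => l ^ w i * valAlgHom P (ψ (y i))) := by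
      ext i
      simpa using hy i
    have h2 : (((valAlgHom P).comp ψ).comp (aeval y)) =
        aeval (fun i => valAlgHom P (ψ (y i))) := by
      ext i
      simp
    have := DFunLike.congr_fun h1 h
    rw [aeval_smul hh, ← h2] at this
    exact this
  refine ⟨aeval y f, aeval y g, isUnit_of_valAlgHom P ?_, valAlgHom_injective P ?_⟩
  · have := isUnit_algebraMap hP
    rw [key hg] at this
    exact isUnit_of_mul_isUnit_right this
  · have := valAlgHom_frac hf hg hP
    rw [key hg, key hf, mul_left_comm] at this
    rw [map_mul]
    exact (hl.pow d).mul_left_cancel this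

/-- A homomorphism from the coordinate ring with values in `R` which makes the polynomials not
vanishing at `P` invertible extends to germs at `P`. -/
def liftLocalization {R : Type*} [CommRing R] [Algebra k R] (g : MvPolynomial σ k →ₐ[k] R)
    (hg : ∀ q ∈ nonvanishing P, IsUnit (g q)) : Localization (nonvanishing P) →ₐ[k] R :=
  IsLocalization.liftAlgHom (M := nonvanishing P) (f := g) fun q => hg q q.2

theorem liftLocalization_algebraMap {R : Type*} [CommRing R] [Algebra k R]
    (g : MvPolynomial σ k →ₐ[k] R) (hg : ∀ q ∈ nonvanishing P, IsUnit (g q))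
    (q : MvPolynomial σ k) : liftLocalization g hg (algebraMap _ _ q) = g q := by
  simp [liftLocalization]

end General

/-! ### The line `ℙ(1, m)` at `x₀ = 0` -/

section Line

variable {k : Type*} [Field k] {m : ℕ}

/-- A monomial `x ^ i * y ^ j` of degree `i + m j = m e` has `m ∣ i`, so it equals `y ^ e * t ^ (i /
m)`. -/
theorem exists_aeval_eq_mul_aeval (hm : m ≠ 0) {e : ℕ} {f : MvPolynomial (Fin 2) k}
    (hf : f.IsWeightedHomogeneous ![1, m] (m * e)) {R : Type*} [CommRing R] [Algebra k R]
    {x y t : R} (h : x ^ m = t * y) :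
    ∃ F : Polynomial k, aeval ![x, y] f = y ^ e * Polynomial.aeval t F := by
  refine ⟨∑ s ∈ f.support, Polynomial.monomial (s 0 / m) (coeff s f), ?_⟩
  rw [aeval_def, eval₂_eq', map_sum, Finset.mul_sum]
  refine Finset.sum_congr rfl fun s hs => ?_
  have hs' := hf (mem_support_iff.mp hs)
  simp only [Finsupp.weight_apply, Finsupp.sum_fintype, Fin.sum_univ_two, smul_eq_mul, zero_mul,
    implies_true, Matrix.cons_val_zero, Matrix.cons_val_one, mul_one] at hs'
  obtain ⟨i, hi⟩ : m ∣ s 0 :=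
    (Nat.dvd_add_left (dvd_mul_left m (s 1))).mp (hs' ▸ dvd_mul_right m e)
  have he : e = i + s 1 := by
    refine Nat.eq_of_mul_eq_mul_left (Nat.pos_of_ne_zero hm) ?_
    rw [← hs', hi]
    ring
  rw [Fin.prod_univ_two, Polynomial.aeval_monomial, hi, Nat.mul_div_cancel_left _
    (Nat.pos_of_ne_zero hm), he]
  simp only [Matrix.cons_val_zero, Matrix.cons_val_one]
  rw [pow_mul, h]
  ring

/-- Where `x₀ = 0` only a pure power of `x₁` can contribute. Hence all denominators at such a point
have degree divisible by `m`. -/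
theorem dvd_of_eval_ne_zero {d : ℕ} {f : MvPolynomial (Fin 2) k}
    (hf : f.IsWeightedHomogeneous ![1, m] d) {x : Fin 2 → k} (hx : x 0 = 0) (h : eval x f ≠ 0) :
    m ∣ d := by
  rw [eval_eq'] at h
  obtain ⟨s, hs, hne⟩ := Finset.exists_ne_zero_of_sum_ne_zero h
  have hs' := hf (mem_support_iff.mp hs)
  simp only [Finsupp.weight_apply, Finsupp.sum_fintype, Fin.sum_univ_two, smul_eq_mul, zero_mul,
    implies_true, Matrix.cons_val_zero, Matrix.cons_val_one, mul_one] at hs'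
  rw [Fin.prod_univ_two, hx] at hne
  have h0 : s 0 = 0 := by
    by_contra h0
    simp [h0] at hne
  rw [← hs', h0, zero_add]
  exact dvd_mul_left _ _

/-- At a point of `ℙ(1, m)` with `x₀ = 0`, the germ `t = x₀ ^ m / x₁` is a local parameter. -/
theorem exists_parameter (hm : m ≠ 0) (P : Point k ![1, m]) {x : Coords k (Fin 2)}
    (hx : mk x = P) (hx0 : x.1 0 = 0) : ∃ t : LocalRing P,
    valAlgHom P t * algebraMap (MvPolynomial (Fin 2) k) _ (X 1) =
      algebraMap (MvPolynomial (Fin 2) k) _ (X 0) ^ m ∧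
    IsLocalRing.maximalIdeal (LocalRing P) = Ideal.span {t} ∧
    ∀ q : LocalRing P, ∃ F G : Polynomial k,
      IsUnit (Polynomial.aeval t G) ∧ q * Polynomial.aeval t G = Polynomial.aeval t F := by
  have hx1 : x.1 1 ≠ 0 := fun h1 => x.2 (funext fun i => by fin_cases i <;> assumption)
  have hX0 : ((X 0 : MvPolynomial (Fin 2) k) ^ m).IsWeightedHomogeneous ![1, m] m := by
    simpa using (isWeightedHomogeneous_X k ![1, m] 0).pow m
  have hX1 : (X 1 : MvPolynomial (Fin 2) k).IsWeightedHomogeneous ![1, m] m :=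
    isWeightedHomogeneous_X k ![1, m] 1
  have hmem : (X 1 : MvPolynomial (Fin 2) k) ∈ nonvanishing P := by
    rw [← hx]
    exact mem_nonvanishing hX1 x (by simpa using hx1)
  have hval := valAlgHom_frac hX0 hX1 hmem
  rw [map_pow] at hval
  have hnotunit : ¬ IsUnit (frac hX0 hX1 hmem) := by
    intro h
    have := (h.map (valAlgHom P)).mul (isUnit_algebraMap hmem)
    rw [hval] at this
    subst hx
    have := this.map (IsLocalization.lift (M := nonvanishing (mk x : Point k ![1, m]))
      (S := Localization (nonvanishing (mk x : Point k ![1, m]))) (g := eval x.1)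
      (fun g => isUnit_iff_ne_zero.mpr (g.2 x rfl)))
    rw [map_pow, IsLocalization.lift_eq] at this
    simp [hx0, hm] at this
  generalize frac hX0 hX1 hmem = t at hval hnotunit
  have hfrac (q : LocalRing P) : ∃ F G : Polynomial k,
      IsUnit (Polynomial.aeval t G) ∧ q * Polynomial.aeval t G = Polynomial.aeval t F := by
    obtain ⟨d, f, g, hf, hg, hP, rfl⟩ := exists_eq_frac q
    have hgx : eval x.1 g ≠ 0 := hP x hx
    obtain ⟨e, rfl⟩ := dvd_of_eval_ne_zero hg hx0 hgx
    have key {h : MvPolynomial (Fin 2) k} (hh : h.IsWeightedHomogeneous ![1, m] (m * e)) :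
        ∃ F : Polynomial k, algebraMap _ (Localization (nonvanishing P)) h =
          algebraMap (MvPolynomial (Fin 2) k) _ (X 1) ^ e *
            valAlgHom P (Polynomial.aeval t F) := by
      obtain ⟨F, hF⟩ := exists_aeval_eq_mul_aeval hm hh hval.symm
      refine ⟨F, ?_⟩
      have h1 : IsScalarTower.toAlgHom k (MvPolynomial (Fin 2) k)
          (Localization (nonvanishing P)) =
          aeval ![algebraMap (MvPolynomial (Fin 2) k) _ (X 0),
            algebraMap (MvPolynomial (Fin 2) k) _ (X 1)] := by
        ext i
        fin_cases i <;> simp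
      rw [Polynomial.aeval_algHom_apply, ← h1] at hF
      exact hF
    obtain ⟨F, hF⟩ := key hf
    obtain ⟨G, hG⟩ := key hg
    have hval' := valAlgHom_frac hf hg hP
    refine ⟨F, G, isUnit_of_valAlgHom P ?_, valAlgHom_injective P ?_⟩
    · have := isUnit_algebraMap hP
      rw [hG] at this
      exact isUnit_of_mul_isUnit_right this
    · rw [hF, hG, mul_left_comm] at hval'
      rw [map_mul]
      exact ((isUnit_algebraMap hmem).pow e).mul_left_cancel hval'
  refine ⟨t, hval, ?_, hfrac⟩
  refine le_antisymm (fun q hq => ?_) ?_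
  · obtain ⟨F, G, hG, h⟩ := hfrac q
    have hF : Polynomial.aeval t F ∈ IsLocalRing.maximalIdeal (LocalRing P) := by
      rw [← h]
      exact Ideal.mul_mem_right _ _ hq
    have ht : t ∈ IsLocalRing.maximalIdeal (LocalRing P) :=
      (IsLocalRing.mem_maximalIdeal _).mpr hnotunit
    -- A nonzero constant term would make `F(t)` a unit, since `t` lies in the maximal ideal.
    have hF0 : F.coeff 0 = 0 := by
      by_contra h0
      rw [← Polynomial.divX_mul_X_add F, map_add, map_mul, Polynomial.aeval_X,
        Polynomial.aeval_C, Ideal.add_mem_iff_right _ (Ideal.mul_mem_left _ _ ht)] at hF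
      exact (IsLocalRing.mem_maximalIdeal _).mp hF ((isUnit_iff_ne_zero.mpr h0).map _)
    rw [← Polynomial.divX_mul_X_add F, hF0, map_zero, add_zero, map_mul, Polynomial.aeval_X] at h
    rw [← Ideal.mul_unit_mem_iff_mem _ hG, h]
    exact Ideal.mul_mem_left _ _ (Ideal.mem_span_singleton_self t)
  · rw [Ideal.span_singleton_le_iff_mem, IsLocalRing.mem_maximalIdeal]
    exact hnotunit

end Line

end WProj

set_option linter.unusedSectionVars false

/-! ### Local analysis in an abstract chart -/

namespace TameRamification

open IsLocalRing

/-- Used twice: with `I` the maximal ideal, to read off residues, and with `I = (s)`, to prove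
divisibility by `s`. -/
theorem aeval_sub_algebraMap_mem {k B : Type*} [Field k] [CommRing B] [Algebra k B] (I : Ideal B)
    {s w : B} {c : k} (hs : s ∈ I) (hw : w - algebraMap k B c ∈ I) (F : MvPolynomial (Fin 2) k) :
    MvPolynomial.aeval ![s, w] F - algebraMap k B (MvPolynomial.eval ![0, c] F) ∈ I := by
  have h : (Ideal.Quotient.mkₐ k I).comp (MvPolynomial.aeval ![s, w]) =
      (Algebra.ofId k (B ⧸ I)).comp (MvPolynomial.aeval ![0, c]) := by
    ext i
    fin_cases i
    · simpa using Ideal.Quotient.eq_zero_iff_mem.mpr hs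
    · simpa using Ideal.Quotient.eq.mpr hw
  exact Ideal.Quotient.eq.mp (DFunLike.congr_fun h F)

variable {k A B : Type*} [Field k] [CharZero k] [CommRing A] [IsLocalRing A] [CommRing B]
  [IsLocalRing B] [Algebra k A] [Algebra k B] [Algebra A B] [IsScalarTower k A B]

/-- `B` is the local ring at a point of a curve over `k` with parameter `s`, given by the equation
`s ^ N = w ^ c * (1 - w ^ a)`, and `A → B` a homomorphism of local rings, where `A` has the
parameter `t`, a unit times `s ^ m`; `θ` is an expansion in a power series ring. -/
structure Chart (a m N c : ℕ) (s w : B) (t : A) (θ : B →ₐ[k] PowerSeries k) : Prop where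
  frac : ∀ b : B, ∃ F G : MvPolynomial (Fin 2) k, IsUnit (MvPolynomial.aeval ![s, w] G) ∧
    b * MvPolynomial.aeval ![s, w] G = MvPolynomial.aeval ![s, w] F
  isUnit : IsUnit w
  rel : s ^ N = w ^ c * (1 - w ^ a)
  dvd : PowerSeries.X ∣ θ s
  associated : Associated (s ^ m) (algebraMap A B t)
  expand_t : θ (algebraMap A B t) = PowerSeries.X ^ m
  maximalIdeal_base : maximalIdeal A = Ideal.span {t}
  frac_base : ∀ q : A, ∃ F G : Polynomial k, IsUnit (Polynomial.aeval t G) ∧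
    q * Polynomial.aeval t G = Polynomial.aeval t F

namespace Chart

variable {a m N c : ℕ} {s w : B} {t : A} {θ : B →ₐ[k] PowerSeries k}
  (h : Chart a m N c s w t θ)


/-- Comparing `θ t = X ^ m` with `θ (s ^ m)` times a unit forces `θ s` to have order exactly one. -/
theorem expand_s (h : Chart a m N c s w t θ) (hm : m ≠ 0) :
    ∃ ρ : PowerSeries k, IsUnit ρ ∧ θ s = PowerSeries.X * ρ := by
  obtain ⟨ρ, hρ⟩ := h.dvd
  refine ⟨ρ, ?_, hρ⟩
  obtain ⟨η, hη⟩ := h.associated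
  have h1 := h.expand_t
  rw [← hη, map_mul, map_pow, hρ, mul_pow, mul_assoc] at h1
  have h2 : ρ ^ m * θ η = 1 :=
    mul_left_cancel₀ (pow_ne_zero m PowerSeries.X_ne_zero) (h1.trans (mul_one _).symm)
  exact (isUnit_pow_iff hm).mp (IsUnit.of_mul_eq_one _ h2)

theorem mem_maximalIdeal (θ : B →ₐ[k] PowerSeries k) {b : B}
    (hb : PowerSeries.constantCoeff (θ b) = 0) : b ∈ maximalIdeal B := by
  rw [IsLocalRing.mem_maximalIdeal]
  intro hu
  have := (hu.map θ).map (PowerSeries.constantCoeff (R := k))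
  rw [hb] at this
  exact not_isUnit_zero this

theorem s_mem (h : Chart a m N c s w t θ) : s ∈ maximalIdeal B :=
  mem_maximalIdeal θ (PowerSeries.X_dvd_iff.mp h.dvd)

theorem one_sub_mem (h : Chart a m N c s w t θ) (hN : N ≠ 0) : 1 - w ^ a ∈ maximalIdeal B := by
  rw [← Ideal.unit_mul_mem_iff_mem _ (h.isUnit.pow c), ← h.rel]
  exact Ideal.pow_mem_of_mem _ h.s_mem _ (Nat.pos_of_ne_zero hN)

/-- The residue `γ` of `w` is a simple root of `1 - w ^ a`, so the equation makes `w - γ` a multiple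
of `s`. A numerator `F(s, w)` in the maximal ideal has `F(0, γ) = 0`, hence lies in `(s, w - γ) =
(s)`. -/
theorem maximalIdeal_eq (h : Chart a m N c s w t θ) (ha : a ≠ 0) (hN : N ≠ 0) :
    maximalIdeal B = Ideal.span {s} := by
  set γ : k := PowerSeries.constantCoeff (θ w) with hγ
  have hγ0 : γ ≠ 0 := ((h.isUnit.map θ).map (PowerSeries.constantCoeff (R := k))).ne_zero
  have hwγ : w - algebraMap k B γ ∈ maximalIdeal B := by
    refine mem_maximalIdeal θ ?_
    rw [map_sub, map_sub, AlgHom.commutes, ← hγ, PowerSeries.algebraMap_apply]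
    simp
  have hγa : γ ^ a = 1 := by
    have h1 := congrArg (fun b => PowerSeries.constantCoeff (θ b)) h.rel
    simp only [map_pow, map_mul, map_sub, map_one, ← hγ, PowerSeries.X_dvd_iff.mp h.dvd,
      zero_pow hN] at h1
    have := (mul_eq_zero.mp h1.symm).resolve_left (pow_ne_zero c hγ0)
    exact (sub_eq_zero.mp this).symm
  have hws : w - algebraMap k B γ ∈ Ideal.span {s} := by
    -- The cofactor of `w - γ` in `w ^ a - γ ^ a`; its residue `a γ ^ (a - 1)` is nonzero.
    let e := ∑ i ∈ Finset.range a, w ^ i * algebraMap k B γ ^ (a - 1 - i)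
    have he : IsUnit e := by
      have hmem : e - algebraMap k B (a * γ ^ (a - 1)) ∈ maximalIdeal B := by
        refine mem_maximalIdeal θ ?_
        have hc (z : k) : PowerSeries.constantCoeff (θ (algebraMap k B z)) = z := by
          rw [AlgHom.commutes, PowerSeries.algebraMap_apply]
          simp
        simp only [e, map_sub, map_sum, map_mul, map_pow, hc, ← hγ]
        rw [sub_eq_zero]
        rw [Finset.sum_congr rfl fun i hi => by
          rw [← pow_add, Nat.add_sub_cancel' (Nat.le_sub_one_of_lt (Finset.mem_range.mp hi))]]
        simp
      by_contra hn
      have h2 := (Submodule.sub_mem_iff_right _ ((IsLocalRing.mem_maximalIdeal _).mpr hn)).mp hmem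
      refine (IsLocalRing.mem_maximalIdeal _).mp h2 (IsUnit.map _ (isUnit_iff_ne_zero.mpr ?_))
      exact mul_ne_zero (Nat.cast_ne_zero.mpr ha) (pow_ne_zero _ hγ0)
    have hprod : e * (w - algebraMap k B γ) = w ^ a - 1 := by
      rw [geom_sum₂_mul, ← map_pow, hγa, map_one]
    rw [← Ideal.unit_mul_mem_iff_mem _ he, hprod, ← Ideal.unit_mul_mem_iff_mem _ (h.isUnit.pow c),
      ← neg_mem_iff, ← mul_neg, neg_sub, ← h.rel]
    exact Ideal.pow_mem_of_mem _ (Ideal.mem_span_singleton_self s) _ (Nat.pos_of_ne_zero hN)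
  refine le_antisymm (fun b hb => ?_) ((Ideal.span_singleton_le_iff_mem _).mpr h.s_mem)
  obtain ⟨F, G, hG, hFG⟩ := h.frac b
  have hF : MvPolynomial.aeval ![s, w] F ∈ maximalIdeal B := hFG ▸ Ideal.mul_mem_right _ _ hb
  have hF0 : MvPolynomial.eval ![0, γ] F = 0 := by
    by_contra h0
    have := (Submodule.sub_mem_iff_right _ hF).mp (aeval_sub_algebraMap_mem _ h.s_mem hwγ F)
    exact (IsLocalRing.mem_maximalIdeal _).mp this ((isUnit_iff_ne_zero.mpr h0).map _)
  have := aeval_sub_algebraMap_mem _ (Ideal.mem_span_singleton_self s) hws F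
  rw [hF0, map_zero, sub_zero, ← hFG] at this
  exact (Ideal.mul_unit_mem_iff_mem _ hG).mp this

theorem isNoetherianRing (h : Chart a m N c s w t θ) : IsNoetherianRing B :=
  isNoetherianRing_of_fractions (MvPolynomial.aeval (R := k) ![s, w]).toRingHom h.frac

theorem not_isNilpotent (h : Chart a m N c s w t θ) (hm : m ≠ 0) : ¬ IsNilpotent s := by
  rintro ⟨i, hi⟩
  obtain ⟨ρ, hρ, hs⟩ := h.expand_s hm
  have := congrArg θ hi
  rw [map_pow, hs, map_zero] at this
  exact pow_ne_zero i (mul_ne_zero PowerSeries.X_ne_zero hρ.ne_zero) this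

theorem isDomain (h : Chart a m N c s w t θ) (ha : a ≠ 0) (hm : m ≠ 0) (hN : N ≠ 0) :
    IsDomain B :=
  have := h.isNoetherianRing
  isDomain_of_maximalIdeal_eq_span (h.maximalIdeal_eq ha hN) (h.not_isNilpotent hm)

theorem isDiscreteValuationRing [IsDomain B] (h : Chart a m N c s w t θ) (ha : a ≠ 0)
    (hm : m ≠ 0) (hN : N ≠ 0) : IsDiscreteValuationRing B :=
  have := h.isNoetherianRing
  isDiscreteValuationRing_of_maximalIdeal_eq_span (h.maximalIdeal_eq ha hN) (h.not_isNilpotent hm)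

/-- Since `θ s` is `X` times a unit, `θ` preserves orders of vanishing. -/
theorem pow_dvd (h : Chart a m N c s w t θ) (ha : a ≠ 0) (hm : m ≠ 0) (hN : N ≠ 0) {e : ℕ}
    {b : B} (hb : PowerSeries.X ^ e ∣ θ b) : s ^ e ∣ b := by
  have := h.isNoetherianRing
  rcases eq_or_ne b 0 with rfl | hb0
  · exact dvd_zero _
  obtain ⟨i, u, hu, rfl⟩ := exists_eq_pow_mul_isUnit (h.maximalIdeal_eq ha hN) hb0
  obtain ⟨ρ, hρ, hs⟩ := h.expand_s hm
  rw [map_mul, map_pow, hs, mul_pow, mul_assoc,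
    IsUnit.dvd_mul_right ((hρ.pow i).mul (hu.map θ)),
    pow_dvd_pow_iff PowerSeries.X_ne_zero PowerSeries.X_prime.not_isUnit] at hb
  exact (pow_dvd_pow s hb).mul_right u

theorem ramificationIdx_eq (h : Chart a m N c s w t θ) (ha : a ≠ 0) (hm : m ≠ 0) (hN : N ≠ 0) :
    Ideal.ramificationIdx' (maximalIdeal A) (maximalIdeal B) = m := by
  obtain ⟨ρ, hρ, hs⟩ := h.expand_s hm
  refine Ideal.ramificationIdx'_spec ?_ ?_
  · rw [h.maximalIdeal_base, Ideal.map_span, Set.image_singleton, h.maximalIdeal_eq ha hN,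
      Ideal.span_singleton_pow, Ideal.span_singleton_le_span_singleton]
    exact h.associated.dvd
  · rw [h.maximalIdeal_base, Ideal.map_span, Set.image_singleton, h.maximalIdeal_eq ha hN,
      Ideal.span_singleton_pow, Ideal.span_singleton_le_span_singleton]
    intro hd
    have h1 := map_dvd θ hd
    rw [h.expand_t, map_pow, hs, mul_pow] at h1
    have := (pow_dvd_pow_iff PowerSeries.X_ne_zero PowerSeries.X_prime.not_isUnit).mp
      ((dvd_mul_right _ _).trans h1)
    omega

/-- Elements of `A` expand to fractions in `X ^ m`. Polynomials are handled by the chain rule,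
quotients by differentiating `q G = F`. -/
theorem derivative_mem (h : Chart a m N c s w t θ) (q : A) :
    PowerSeries.derivative k (θ (algebraMap A B q)) ∈
      Ideal.span {(PowerSeries.X : PowerSeries k) ^ (m - 1)} := by
  obtain ⟨F, G, hG, hFG⟩ := h.frac_base q
  let η : A →ₐ[k] PowerSeries k := θ.comp (IsScalarTower.toAlgHom k A B)
  have hη (z : A) : θ (algebraMap A B z) = η z := rfl
  have hηt : η t = PowerSeries.X ^ m := h.expand_t
  have key (F : Polynomial k) : PowerSeries.derivative k (η (Polynomial.aeval t F)) ∈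
      Ideal.span {(PowerSeries.X : PowerSeries k) ^ (m - 1)} := by
    rw [← Polynomial.aeval_algHom_apply, hηt, Derivation.map_aeval, Derivation.leibniz_pow,
      smul_eq_mul, nsmul_eq_mul, smul_eq_mul, Ideal.mem_span_singleton]
    exact ((dvd_mul_right _ _).mul_left _).mul_left _
  have h1 := congrArg (fun z => PowerSeries.derivative k (η z)) hFG
  simp only [map_mul, Derivation.leibniz, smul_eq_mul] at h1
  have h2 := key F
  rw [← h1, Ideal.add_mem_iff_right _ (Ideal.mul_mem_left _ _ (key G))] at h2
  exact (Ideal.unit_mul_mem_iff_mem _ (hG.map η)).mp h2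

local notation "d" => KaehlerDifferential.D A B

/-- In the differential of the chart equation, the coefficient of `dw` is `-a w ^ c w ^ (a - 1)`
modulo the maximal ideal, a unit in characteristic zero. For `c = 0` the truncated exponent `c - 1`
only occurs with coefficient zero. -/
theorem D_w_mem (h : Chart a m N c s w t θ) (ha : a ≠ 0) (hN : N ≠ 0) :
    d w ∈ Submodule.span B {d s} := by
  have h1 := congrArg d h.rel
  simp only [Derivation.leibniz, Derivation.leibniz_pow, map_sub, Derivation.map_one_eq_zero,
    zero_sub] at h1
  have h2 : ((1 - w ^ a) * (c * w ^ (c - 1)) - w ^ c * (a * w ^ (a - 1))) • d w =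
      (N * s ^ (N - 1)) • d s := by
    simp only [sub_smul, mul_smul, Nat.cast_smul_eq_nsmul, h1]
    simp only [smul_neg]
    abel
  have hcast (i : ℕ) (hi : i ≠ 0) : IsUnit (i : B) := by
    have := (isUnit_iff_ne_zero.mpr (Nat.cast_ne_zero.mpr hi : (i : k) ≠ 0)).map (algebraMap k B)
    rwa [map_natCast] at this
  have hu : IsUnit ((1 - w ^ a) * (c * w ^ (c - 1)) - w ^ c * (a * w ^ (a - 1))) := by
    by_contra hn
    have h3 := (Submodule.sub_mem_iff_right _ (Ideal.mul_mem_right _ _ (h.one_sub_mem hN))).mp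
      ((IsLocalRing.mem_maximalIdeal _).mpr hn)
    exact (IsLocalRing.mem_maximalIdeal _).mp h3
      ((h.isUnit.pow c).mul ((hcast a ha).mul (h.isUnit.pow _)))
  rw [← Submodule.smul_mem_iff_of_isUnit _ hu, h2]
  exact Submodule.smul_mem _ _ (Submodule.mem_span_singleton_self _)

theorem D_mem (h : Chart a m N c s w t θ) (ha : a ≠ 0) (hN : N ≠ 0) (b : B) :
    d b ∈ Submodule.span B {d s} := by
  have key (F : MvPolynomial (Fin 2) k) :
      d (MvPolynomial.aeval ![s, w] F) ∈ Submodule.span B {d s} := by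
    induction F using MvPolynomial.induction_on with
    | C z =>
      rw [MvPolynomial.aeval_C, IsScalarTower.algebraMap_apply k A B, Derivation.map_algebraMap]
      exact Submodule.zero_mem _
    | add p q hp hq =>
      rw [map_add, map_add]
      exact Submodule.add_mem _ hp hq
    | mul_X p i hp =>
      rw [map_mul, Derivation.leibniz, MvPolynomial.aeval_X]
      refine Submodule.add_mem _ (Submodule.smul_mem _ _ ?_) (Submodule.smul_mem _ _ hp)
      fin_cases i
      · exact Submodule.mem_span_singleton_self _
      · exact h.D_w_mem ha hN
  obtain ⟨F, G, hG, hFG⟩ := h.frac b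
  have h1 := key F
  rw [← hFG, Derivation.leibniz,
    Submodule.add_mem_iff_right _ (Submodule.smul_mem _ _ (key G))] at h1
  exact (Submodule.smul_mem_iff_of_isUnit _ hG).mp h1

/-- Write `t = s ^ m η` and `dη = e ds`. Then `dt = 0` reads `(s e + m η) s ^ (m - 1) ds = 0`, and
the bracket is a unit because `m` is invertible: the ramification is tame. -/
theorem pow_smul_D_eq_zero (h : Chart a m N c s w t θ) (ha : a ≠ 0) (hm : m ≠ 0) (hN : N ≠ 0) :
    s ^ (m - 1) • d s = 0 := by
  obtain ⟨η, hη⟩ := h.associated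
  obtain ⟨e, he⟩ := Submodule.mem_span_singleton.mp (h.D_mem ha hN η)
  have h1 := congrArg d hη
  rw [Derivation.map_algebraMap, Derivation.leibniz, Derivation.leibniz_pow, ← he] at h1
  have hs : s ^ m = s * s ^ (m - 1) := (mul_pow_sub_one hm s).symm
  have h2 : (s * e + η * m) • s ^ (m - 1) • d s = 0 := by
    rw [← h1, hs]
    simp only [← Nat.cast_smul_eq_nsmul B, smul_smul, ← add_smul]
    congr 1
    ring
  have hcast : IsUnit (m : B) := by
    have := (isUnit_iff_ne_zero.mpr (Nat.cast_ne_zero.mpr hm : (m : k) ≠ 0)).map (algebraMap k B)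
    rwa [map_natCast] at this
  have hu : IsUnit (s * e + η * m) := by
    by_contra hn
    have h3 := (Ideal.add_mem_iff_right _ (Ideal.mul_mem_right _ _ h.s_mem)).mp
      ((IsLocalRing.mem_maximalIdeal _).mpr hn)
    exact (IsLocalRing.mem_maximalIdeal _).mp h3 (η.isUnit.mul hcast)
  exact (hu.smul_eq_zero).mp h2

theorem length_eq (h : Chart a m N c s w t θ) (ha : a ≠ 0) (hm : m ≠ 0) (hN : N ≠ 0) :
    Module.length B (Ω[B⁄A]) = (m - 1 : ℕ) := by
  have := h.isDomain ha hm hN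
  have := h.isDiscreteValuationRing ha hm hN
  refine KaehlerDifferential.length_of_isDiscreteValuationRing (h.maximalIdeal_eq ha hN)
    θ.toRingHom (PowerSeries.derivative k) (m - 1)
    (Ideal.span {(PowerSeries.X : PowerSeries k) ^ (m - 1)}) h.derivative_mem ?_
    (fun b hb => h.pow_dvd ha hm hN (Ideal.mem_span_singleton.mp hb)) (h.D_mem ha hN)
    (h.pow_smul_D_eq_zero ha hm hN)
  obtain ⟨ρ, hρ, hs⟩ := h.expand_s hm
  -- The derivative of `θ s = X ρ` has the nonzero constant term of `ρ`.
  change IsUnit (PowerSeries.derivative k (θ s))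
  rw [hs, Derivation.leibniz, PowerSeries.isUnit_iff_constantCoeff]
  simpa using PowerSeries.isUnit_iff_constantCoeff.mp hρ

end Chart
end TameRamification

/-! ### Torus coordinates and expansions on the curve -/

namespace FermatType

open MvPolynomial WProj

variable {k : Type*} [Field k] {a m n : ℕ}

section Pullback

variable [NeZero a] [NeZero m] [NeZero n] (P : Curve k a m n)

/-- Pull-back of fractions along the projection `(x₀, x₁, x₂) ↦ (x₀, x₁)`. -/
def pullbackFractions : Localization (nonvanishing (phi P)) →ₐ[k] Localization (nonvanishing P.1) :=
  liftLocalization ((IsScalarTower.toAlgHom k (MvPolynomial (Fin 3) k) _).comp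
    (rename Fin.castSucc)) fun _ hq => isUnit_algebraMap (nonvanishing_le P hq)

theorem pullbackFractions_algebraMap (p : MvPolynomial (Fin 2) k) :
    pullbackFractions P (algebraMap _ _ p) = algebraMap _ _ (inclusion k m n p) :=
  liftLocalization_algebraMap _ _ p

/-- Lets identities between germs on the line be transported to the plane as identities of
fractions. -/
theorem valAlgHom_map (q : WProj.LocalRing (phi P)) :
    valAlgHom P.1 (HomogeneousLocalization.map (inclusion k m n) (nonvanishing_le P) q) =
      pullbackFractions P (valAlgHom (phi P) q) := by
  obtain ⟨d, f, g, hf, hg, hP, rfl⟩ := exists_eq_frac q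
  refine (isUnit_algebraMap (nonvanishing_le P hP)).mul_right_cancel ?_
  have h1 := congrArg (pullbackFractions P) (valAlgHom_frac hf hg hP)
  rw [map_mul, pullbackFractions_algebraMap, pullbackFractions_algebraMap] at h1
  rw [h1]
  exact valAlgHom_frac ((inclusion k m n).map_mem hf) ((inclusion k m n).map_mem hg)
    (nonvanishing_le P hP)

instance isScalarTower_pullback : IsScalarTower k (WProj.LocalRing (phi P)) (LocalRing P) :=
  IsScalarTower.of_algebraMap_eq (R := k) (S := WProj.LocalRing (phi P)) (A := LocalRing P)
    fun c => by
    refine congrArg (Ideal.Quotient.mk (idealAt P)) (a₁ := algebraMap k (WProj.LocalRing P.1) c)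
      (a₂ := HomogeneousLocalization.map (inclusion k m n) (nonvanishing_le P)
        (algebraMap k (WProj.LocalRing (phi P)) c)) ?_
    apply valAlgHom_injective
    rw [valAlgHom_map, AlgHom.commutes, AlgHom.commutes, AlgHom.commutes]

end Pullback

theorem exists_bezout (hm : 0 < m) (hn : 0 < n) (h : Nat.Coprime m n) :
    ∃ u v : ℕ, n * v = 1 + m * u := by
  obtain ⟨x, hx, hx'⟩ := Nat.chineseRemainder h 1 0
  -- Below, `v` is replaced by `v + m`: the residue modulo `m` is unchanged and the product is at
  -- least `1`, so `u` is a natural number.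
  obtain ⟨v, rfl⟩ := (Nat.modEq_zero_iff_dvd).mp hx'
  have h1 : 1 ≤ n * (v + m) := Nat.mul_pos hn (by omega)
  have h2 : 1 ≡ n * (v + m) [MOD m] := by
    rw [mul_add]
    exact hx.symm.trans (by simp [Nat.ModEq])
  obtain ⟨u, hu⟩ := (Nat.modEq_iff_dvd' h1).mp h2
  exact ⟨u, v + m, by omega⟩

/-- Change of coordinates in a torus of dimension two. -/
theorem torus_chart {R : Type*} [CommRing R] {x₀ x₁ x₂ S W l : R} {u v : ℕ} (h₁ : IsUnit x₁)
    (h₂ : IsUnit x₂) (huv : n * v = 1 + m * u) (hS : S * x₂ ^ v = x₀ * x₁ ^ u)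
    (hW : W * x₂ ^ m = x₁ ^ n) (hl : l * x₁ ^ u = x₂ ^ v) :
    x₀ = l * S ∧ x₁ = l ^ m * W ^ v ∧ x₂ = l ^ n * W ^ u := by
  refine ⟨(h₁.pow u).mul_right_cancel ?_, ?_, ?_⟩
  · rw [← hS, ← hl]
    ring
  · refine ((h₁.pow (u * m)).mul (h₂.pow (m * v))).mul_right_cancel ?_
    calc x₁ * (x₁ ^ (u * m) * x₂ ^ (m * v)) = x₁ ^ (n * v) * x₂ ^ (m * v) := by rw [huv]; ring
      _ = (l * x₁ ^ u) ^ m * (W * x₂ ^ m) ^ v := by rw [hl, hW]; ring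
      _ = _ := by ring
  · refine ((h₁.pow (u * n)).mul (h₂.pow (m * u))).mul_right_cancel ?_
    calc x₂ * (x₁ ^ (u * n) * x₂ ^ (m * u)) = x₂ ^ (n * v) * x₁ ^ (u * n) := by rw [huv]; ring
      _ = (l * x₁ ^ u) ^ n * (W * x₂ ^ m) ^ u := by rw [hl, hW]; ring
      _ = _ := by ring

/-- The equation of the curve in the coordinates `S`, `W`. -/
theorem torus_equation {R : Type*} [CommRing R] {x₀ x₁ x₂ S W : R} {u v : ℕ}
    (huv : n * v = 1 + m * u) (hS : S * x₂ ^ v = x₀ * x₁ ^ u) (hW : W * x₂ ^ m = x₁ ^ n) :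
    (S ^ (a * m * n) - W ^ (u * a * m) * (1 - W ^ a)) * x₂ ^ (v * (a * m * n)) =
      x₁ ^ (u * (a * m * n)) * (x₀ ^ (a * m * n) + x₁ ^ (a * n) - x₂ ^ (a * m)) := by
  have h1 : S ^ (a * m * n) * x₂ ^ (v * (a * m * n)) =
      x₀ ^ (a * m * n) * x₁ ^ (u * (a * m * n)) := by
    rw [pow_mul x₂, ← mul_pow, hS, mul_pow, ← pow_mul]
  have h2 : v * (a * m * n) = m * (u * a * m) + m * a := by
    calc v * (a * m * n) = (n * v) * (a * m) := by ring
      _ = _ := by rw [huv]; ring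
  have h3 : W ^ (u * a * m) * (1 - W ^ a) * x₂ ^ (v * (a * m * n)) =
      x₁ ^ (u * (a * m * n)) * (x₂ ^ (a * m) - x₁ ^ (a * n)) := by
    calc _ = (W * x₂ ^ m) ^ (u * a * m) * (x₂ ^ (a * m) - (W * x₂ ^ m) ^ a) := by rw [h2]; ring
      _ = _ := by rw [hW]; ring
  rw [sub_mul, h1, h3]
  ring

section Expansion

variable (P : Curve k a m n) {x : Coords k (Fin 3)}

/-- The constant term of `q(X, 1, ρ)` is the value of `q` at the coordinate vector of `P`. -/
theorem isUnit_aeval_powerSeries (hx : WProj.mk x = P.1) (hx0 : x.1 0 = 0) (hx1 : x.1 1 = 1)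
    {ρ : PowerSeries k} (hρ : PowerSeries.constantCoeff ρ = x.1 2) (q : MvPolynomial (Fin 3) k)
    (hq : q ∈ nonvanishing P.1) : IsUnit (aeval ![PowerSeries.X, 1, ρ] q) := by
  rw [PowerSeries.isUnit_iff_constantCoeff, isUnit_iff_ne_zero]
  have h : (PowerSeries.constantCoeff (R := k)).comp
      (aeval ![PowerSeries.X, 1, ρ] : MvPolynomial (Fin 3) k →ₐ[k] PowerSeries k).toRingHom =
      eval x.1 := by
    ext i
    · simp
    · fin_cases i <;> simp [hx0, hx1, hρ]
  have := hq x hx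
  rw [← h] at this
  exact this

/-- A power series solution `ρ` of the equation, with `x₀ = X` and `x₁ = 1`, gives an expansion of
the germs on `C`. -/
def expansion (hx : WProj.mk x = P.1) (hx0 : x.1 0 = 0) (hx1 : x.1 1 = 1)
    {ρ : PowerSeries k} (hρ : PowerSeries.constantCoeff ρ = x.1 2)
    (hρP : ρ ^ (a * m) = 1 + PowerSeries.X ^ (a * m * n)) : LocalRing P →ₐ[k] PowerSeries k :=
  Ideal.Quotient.liftₐ (idealAt P)
    ((liftLocalization _ (isUnit_aeval_powerSeries P hx hx0 hx1 hρ)).comp (valAlgHom P.1))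
    (by
      intro q hq
      have h1 : valAlgHom P.1 q ∈ (Ideal.span {poly k a m n}).map (algebraMap _ _) := hq
      have h2 := Ideal.mem_map_of_mem
        (liftLocalization _ (isUnit_aeval_powerSeries P hx hx0 hx1 hρ)) h1
      rw [Ideal.map_span, Set.image_singleton, Ideal.map_span, Set.image_singleton,
        liftLocalization_algebraMap] at h2
      have h3 : aeval ![PowerSeries.X, 1, ρ] (poly k a m n) = 0 := by
        simp [poly, hρP, add_comm]
      rw [h3, Ideal.span_singleton_zero] at h2
      exact h2)

end Expansion

variable [CharZero k] [NeZero a] [NeZero m] [NeZero n]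

theorem exists_chart (hcop : Nat.Coprime m n) (P : Curve k a m n) {x : Coords k (Fin 3)}
    (hx : WProj.mk x = P.1) (hx0 : x.1 0 = 0) (hx1 : x.1 1 = 1) :
    ∃ (c : ℕ) (s w : LocalRing P) (t : WProj.LocalRing (phi P))
      (θ : LocalRing P →ₐ[k] PowerSeries k),
      TameRamification.Chart a m (a * m * n) c s w t θ := by
  have ha := NeZero.ne a
  have hm := NeZero.ne m
  have hn := NeZero.ne n
  obtain ⟨u, v, huv⟩ := exists_bezout (Nat.pos_of_ne_zero hm) (Nat.pos_of_ne_zero hn) hcop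
  have hxeq : x.1 2 ^ (a * m) = 1 := by
    have := (mem_curve_iff (a := a) (m := m) (n := n) x).mp (hx ▸ P.2)
    rw [hx0, hx1, zero_pow (by positivity), one_pow, zero_add] at this
    exact this.symm
  have hx2 : x.1 2 ≠ 0 := fun h => by
    rw [h, zero_pow (by positivity)] at hxeq
    exact zero_ne_one hxeq
  -- `ρ` expands `x₂` along the branch of `C` through `P`, with `x₀ = X` and `x₁ = 1`.
  obtain ⟨ρ, hρP, hρ⟩ := PowerSeries.exists_pow_eq (N := a * m) (by positivity)
    (1 + PowerSeries.X ^ (a * m * n) : PowerSeries k) hx2 (by simp [hxeq, ha, hm, hn])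
  have hX0 : (X 0 : MvPolynomial (Fin 3) k).IsWeightedHomogeneous ![1, m, n] 1 :=
    isWeightedHomogeneous_X k ![1, m, n] 0
  have hX1 : (X 1 : MvPolynomial (Fin 3) k).IsWeightedHomogeneous ![1, m, n] m :=
    isWeightedHomogeneous_X k ![1, m, n] 1
  have hX2 : (X 2 : MvPolynomial (Fin 3) k).IsWeightedHomogeneous ![1, m, n] n :=
    isWeightedHomogeneous_X k ![1, m, n] 2
  have hmem1 : (X 1 : MvPolynomial (Fin 3) k) ∈ nonvanishing P.1 := by
    rw [← hx]
    exact mem_nonvanishing hX1 x (by simp [hx1])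
  have hmem2 : (X 2 : MvPolynomial (Fin 3) k) ∈ nonvanishing P.1 := by
    rw [← hx]
    exact mem_nonvanishing hX2 x (by simpa using hx2)
  have hSn : (X 0 * X 1 ^ u : MvPolynomial (Fin 3) k).IsWeightedHomogeneous ![1, m, n] (n * v) := by
    rw [huv]
    simpa [mul_comm] using hX0.mul (hX1.pow u)
  have hSd : (X 2 ^ v : MvPolynomial (Fin 3) k).IsWeightedHomogeneous ![1, m, n] (n * v) := by
    simpa [mul_comm] using hX2.pow v
  have hWn : (X 1 ^ n : MvPolynomial (Fin 3) k).IsWeightedHomogeneous ![1, m, n] (n * m) := by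
    simpa using hX1.pow n
  have hWd : (X 2 ^ m : MvPolynomial (Fin 3) k).IsWeightedHomogeneous ![1, m, n] (n * m) := by
    simpa [mul_comm] using hX2.pow m
  have hS := valAlgHom_frac hSn hSd (pow_mem hmem2 v)
  have hW := valAlgHom_frac hWn hWd (pow_mem hmem2 m)
  generalize frac hSn hSd (pow_mem hmem2 v) = S at hS
  generalize frac hWn hWd (pow_mem hmem2 m) = W at hW
  obtain ⟨t, ht, htmax, htfrac⟩ := exists_parameter hm (phi P) (phi_eq P x hx).symm hx0
  have h1 := isUnit_algebraMap hmem1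
  have h2 := isUnit_algebraMap hmem2
  simp only [map_mul, map_pow] at hS hW
  have hWu : IsUnit W := isUnit_of_valAlgHom P.1
    (isUnit_of_mul_isUnit_left (y := algebraMap _ _ (X 2) ^ m) (hW ▸ h1.pow n))
  obtain ⟨l, hlu, hl⟩ : ∃ l : Localization (nonvanishing P.1), IsUnit l ∧
      l * algebraMap (MvPolynomial (Fin 3) k) _ (X 1) ^ u =
        algebraMap (MvPolynomial (Fin 3) k) _ (X 2) ^ v := by
    obtain ⟨z, hz⟩ := h1.pow u
    exact ⟨_, (h2.pow v).mul z⁻¹.isUnit, by rw [← hz, mul_assoc, Units.inv_mul, mul_one]⟩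
  obtain ⟨e0, e1, e2⟩ := torus_chart h1 h2 huv hS hW hl
  have hT := congrArg (pullbackFractions P) ht
  have hres (i : Fin 2) : pullbackFractions P (algebraMap (MvPolynomial (Fin 2) k) _ (X i)) =
      algebraMap (MvPolynomial (Fin 3) k) _ (X i.castSucc) := by
    rw [pullbackFractions_algebraMap]
    exact congrArg _ (rename_X _ i)
  rw [map_mul, map_pow, hres, hres, ← valAlgHom_map] at hT
  change _ * algebraMap (MvPolynomial (Fin 3) k) _ (X 1) =
    algebraMap (MvPolynomial (Fin 3) k) _ (X 0) ^ m at hT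
  generalize hTdef : HomogeneousLocalization.map (inclusion k m n) (nonvanishing_le P) t = T at hT
  have hTalg : algebraMap (WProj.LocalRing (phi P)) (LocalRing P) t =
    Ideal.Quotient.mk (idealAt P) T := congrArg _ hTdef
  have hlift (q : MvPolynomial (Fin 3) k) := liftLocalization_algebraMap _
    (isUnit_aeval_powerSeries P hx hx0 hx1 hρ) q
  refine ⟨u * a * m, Ideal.Quotient.mk (idealAt P) S, Ideal.Quotient.mk (idealAt P) W, t,
    expansion P hx hx0 hx1 hρ hρP, ?_, hWu.map _, ?_, ?_, ?_, ?_, htmax, htfrac⟩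
  · intro b
    obtain ⟨q, rfl⟩ := Ideal.Quotient.mk_surjective b
    obtain ⟨F, G, hG, hFG⟩ := exists_fraction_of_chart
      (aeval ![S, W] : MvPolynomial (Fin 2) k →ₐ[k] WProj.LocalRing P.1) hlu
      ![X 0, X 1 ^ v, X 1 ^ u] (by
        intro i
        fin_cases i
        · simpa using e0
        · simpa using e1
        · simpa using e2) q
    have hψ : (aeval ![Ideal.Quotient.mk (idealAt P) S, Ideal.Quotient.mk (idealAt P) W] :
        MvPolynomial (Fin 2) k →ₐ[k] LocalRing P) =
        (Ideal.Quotient.mkₐ k (idealAt P)).comp (aeval ![S, W]) := by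
      ext i
      fin_cases i <;> simp
    rw [hψ]
    exact ⟨F, G, hG.map (Ideal.Quotient.mk (idealAt P)),
      ((map_mul (Ideal.Quotient.mk (idealAt P)) _ _).symm.trans (congrArg _ hFG))⟩
  · rw [← sub_eq_zero, ← map_one (Ideal.Quotient.mk (idealAt P))]
    simp only [← map_pow, ← map_mul, ← map_sub]
    rw [Ideal.Quotient.eq_zero_iff_mem]
    change valAlgHom P.1 _ ∈ (Ideal.span {poly k a m n}).map (algebraMap _ _)
    -- Clearing the denominator `x₂ ^ v` of `S` turns the relation into a multiple of the equation
    -- of `C`.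
    rw [← Ideal.mul_unit_mem_iff_mem _ (h2.pow (v * (a * m * n)))]
    simp only [map_pow, map_mul, map_sub, map_one]
    rw [torus_equation huv hS hW]
    refine Ideal.mul_mem_left _ _ ?_
    have := Ideal.mem_map_of_mem (algebraMap _ (Localization (nonvanishing P.1)))
      (Ideal.mem_span_singleton_self (poly k a m n))
    simpa [poly] using this
  · have h3 := congrArg (liftLocalization _ (isUnit_aeval_powerSeries P hx hx0 hx1 hρ)) hS
    simp only [map_mul, map_pow, hlift, aeval_X] at h3
    have hρu : IsUnit ρ := by
      rw [PowerSeries.isUnit_iff_constantCoeff, hρ]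
      exact isUnit_iff_ne_zero.mpr hx2
    refine ((hρu.pow v).dvd_mul_right).mp (Dvd.intro 1 ?_)
    refine Eq.trans ?_ h3.symm
    simp
  -- The identity behind the ramification index: `t W ^ v = S ^ m`.
  · obtain ⟨z, hz⟩ := hWu.pow v
    refine Associated.symm ⟨Units.map (Ideal.Quotient.mk (idealAt P)).toMonoidHom z, ?_⟩
    rw [hTalg]
    change Ideal.Quotient.mk (idealAt P) T * Ideal.Quotient.mk (idealAt P) z = _
    rw [hz, ← map_mul, ← map_pow]
    congr 1
    apply valAlgHom_injective
    rw [map_mul, map_pow, map_pow]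
    refine (h1.mul (h2.pow (v * m))).mul_right_cancel ?_
    calc _ = valAlgHom P.1 T * algebraMap (MvPolynomial (Fin 3) k) _ (X 1) *
          (valAlgHom P.1 W * algebraMap (MvPolynomial (Fin 3) k) _ (X 2) ^ m) ^ v := by ring
      _ = algebraMap (MvPolynomial (Fin 3) k) _ (X 0) ^ m *
          algebraMap (MvPolynomial (Fin 3) k) _ (X 1) ^ (n * v) := by rw [hT, hW]; ring
      _ = (algebraMap (MvPolynomial (Fin 3) k) _ (X 0) *
          algebraMap (MvPolynomial (Fin 3) k) _ (X 1) ^ u) ^ m *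
            algebraMap (MvPolynomial (Fin 3) k) _ (X 1) := by rw [huv]; ring
      _ = _ := by rw [← hS]; ring
  · rw [hTalg]
    have h3 := congrArg (liftLocalization _ (isUnit_aeval_powerSeries P hx hx0 hx1 hρ)) hT
    simp only [map_mul, map_pow, hlift, aeval_X] at h3
    simp only [Matrix.cons_val_one, Matrix.cons_val_zero, mul_one] at h3
    exact h3

end FermatType

/-! ### The points of the curve on `x₀ = 0` -/

namespace FermatType

open WProj

variable {k : Type*} [Field k] {a m n : ℕ}

theorem mul_ceilDiv'_last (hm : m ≠ 0) : ceilDiv' m n m = n := by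
  have hm' : (m : ℚ) ≠ 0 := Nat.cast_ne_zero.mpr hm
  rw [ceilDiv', if_neg hm, Nat.cast_mul, mul_div_cancel_left₀ _ hm', Nat.ceil_natCast]

/-- A zero exponent would give `m ∣ j n`, hence `m ∣ j`. For `j = 0` the convention `⌈0⌉ = 1` makes
the exponent `m`. -/
theorem exponent_pos (hcop : Nat.Coprime m n) {j : ℕ} (hj : j < m) :
    m * ceilDiv' m n j - j * n ≠ 0 := by
  unfold ceilDiv'
  split_ifs with h
  · subst h
    omega
  · have hm : (0 : ℚ) < m := by exact_mod_cast (Nat.zero_le j).trans_lt hj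
    have h1 := Nat.le_ceil (((j * n : ℕ) : ℚ) / (m : ℚ))
    rw [div_le_iff₀ hm] at h1
    have h2 : j * n ≤ ⌈((j * n : ℕ) : ℚ) / (m : ℚ)⌉₊ * m := by exact_mod_cast h1
    intro h0
    have h3 : j * n = m * ⌈((j * n : ℕ) : ℚ) / (m : ℚ)⌉₊ := by rw [mul_comm m] at h0 ⊢; omega
    have h4 : m ∣ j := hcop.dvd_of_dvd_mul_right (h3 ▸ dvd_mul_right _ _)
    exact absurd (Nat.le_of_dvd (Nat.pos_of_ne_zero h) h4) (by omega)

/-- The vector `(0, 1, ω)`. -/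
def boundaryVector (ω : k) : Coords k (Fin 3) :=
  ⟨![0, 1, ω], fun h => one_ne_zero (congrFun h 1)⟩

/-- The point `[0, 1, ω]` of `C`, where `ω ^ (a * m) = 1`. -/
def boundaryPoint [NeZero a] [NeZero m] [NeZero n] (ω : k) (hω : ω ^ (a * m) = 1) :
    Curve k a m n :=
  ⟨WProj.mk (boundaryVector ω), (mem_curve_iff _).mpr (by
    have h : a * m * n ≠ 0 := mul_ne_zero (mul_ne_zero (NeZero.ne a) (NeZero.ne m)) (NeZero.ne n)
    simp [boundaryVector, hω, zero_pow h])⟩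

section

variable [NeZero a] [NeZero m] [NeZero n] {ω : k} (hω : ω ^ (a * m) = 1)

theorem exists_of_mk_eq_boundaryPoint {y : Coords k (Fin 3)}
    (hy : WProj.mk y = (boundaryPoint (n := n) ω hω).1) :
    ∃ t : kˣ, y.1 0 = 0 ∧ y.1 1 = (t : k) ^ m ∧ y.1 2 = (t : k) ^ n * ω := by
  obtain ⟨t, ht⟩ := mk_eq_mk.mp hy.symm
  refine ⟨t, ?_, ?_, ?_⟩
  · simpa [boundaryVector] using ht 0
  · simpa [boundaryVector] using ht 1
  · simpa [boundaryVector] using ht 2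

theorem boundaryPoint_mem_onLine : boundaryPoint (n := n) ω hω ∈ onLine k a m n := fun _ hy =>
  let ⟨_, h0, _⟩ := exists_of_mk_eq_boundaryPoint hω hy
  h0

theorem hasLocalCoords_boundaryPoint (hcop : Nat.Coprime m n) :
    HasLocalCoords (boundaryPoint (n := n) ω hω).1 (Pi.single (Fin.last m) (ω ^ m)) := by
  intro y hy
  obtain ⟨t, h0, h1, h2⟩ := exists_of_mk_eq_boundaryPoint hω hy
  have ht : (t : k) ≠ 0 := t.ne_zero
  refine ⟨h1 ▸ pow_ne_zero m ht, fun j => ?_⟩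
  rcases eq_or_ne j (Fin.last m) with rfl | hj
  · rw [Pi.single_eq_same, Fin.val_last, mul_ceilDiv'_last (NeZero.ne m), Nat.sub_self, pow_zero,
      one_mul, h1, h2, mul_pow, ← pow_mul, ← pow_mul, mul_comm m n,
      mul_div_cancel_left₀ _ (pow_ne_zero _ ht)]
  · have hjm : (j : ℕ) < m := lt_of_le_of_ne (Nat.le_of_lt_succ j.2) fun h => hj (Fin.ext h)
    rw [Pi.single_eq_of_ne hj, h0, zero_pow (exponent_pos hcop hjm), zero_mul, zero_div]

end

/-- The cuspidal curve `r ^ m = y ^ n` is parametrized by `(t ^ n, t ^ m)`; Bezout's relation gives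
the inverse `t = r ^ v / y ^ u`. -/
theorem exists_pow_eq_of_pow_eq_pow (hm : 0 < m) (hn : 0 < n) (hcop : Nat.Coprime m n) {r y : k}
    (hr : r ≠ 0) (hy : y ≠ 0) (h : r ^ m = y ^ n) : ∃ t : kˣ, (t : k) ^ m = y ∧ (t : k) ^ n = r := by
  obtain ⟨u, v, huv⟩ := exists_bezout hm hn hcop
  refine ⟨Units.mk0 (r ^ v / y ^ u) (div_ne_zero (pow_ne_zero v hr) (pow_ne_zero u hy)), ?_, ?_⟩
  · rw [Units.val_mk0, div_pow, div_eq_iff (pow_ne_zero _ (pow_ne_zero _ hy))]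
    calc (r ^ v) ^ m = (r ^ m) ^ v := by ring
      _ = y ^ (n * v) := by rw [h, pow_mul]
      _ = _ := by rw [huv]; ring
  · rw [Units.val_mk0, div_pow, div_eq_iff (pow_ne_zero _ (pow_ne_zero _ hy))]
    calc (r ^ v) ^ n = r ^ (n * v) := by ring
      _ = r * (r ^ m) ^ u := by rw [huv]; ring
      _ = _ := by rw [h]; ring

theorem exists_boundary_of_mem_onLine [NeZero a] [NeZero m] [NeZero n] {Q : Curve k a m n}
    (hQ : Q ∈ onLine k a m n) : ∃ y : Coords k (Fin 3), WProj.mk y = Q.1 ∧ y.1 0 = 0 ∧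
      y.1 1 ≠ 0 ∧ y.1 2 ≠ 0 ∧ y.1 1 ^ (a * n) = y.1 2 ^ (a * m) := by
  obtain ⟨y, hy⟩ := exists_rep Q.1
  have h0 := hQ y hy
  have ha := NeZero.ne a
  have hm := NeZero.ne m
  have hn := NeZero.ne n
  have heq : y.1 1 ^ (a * n) = y.1 2 ^ (a * m) := by
    have := (mem_curve_iff (a := a) (m := m) (n := n) y).mp (hy ▸ Q.2)
    rwa [h0, zero_pow (by positivity), zero_add] at this
  have h12 : y.1 1 = 0 ↔ y.1 2 = 0 := by
    rw [← pow_eq_zero_iff (mul_ne_zero ha hn), heq, pow_eq_zero_iff (mul_ne_zero ha hm)]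
  have h1 : y.1 1 ≠ 0 := by
    intro h1
    refine y.2 (funext fun i => ?_)
    fin_cases i
    · exact h0
    · exact h1
    · exact h12.mp h1
  exact ⟨y, hy, h0, h1, fun h => h1 (h12.mpr h), heq⟩

/-- The invariant `x₂ ^ m / x₁ ^ n` separates the points on `x₀ = 0`: equality of invariants says
that `(x₂ / ω) ^ m = x₁ ^ n`, which yields the rescaling factor `t`. -/
theorem eq_boundaryPoint [NeZero a] [NeZero m] [NeZero n] (hcop : Nat.Coprime m n)
    {Q : Curve k a m n} {y : Coords k (Fin 3)} (hy : WProj.mk y = Q.1) (h0 : y.1 0 = 0)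
    (h1 : y.1 1 ≠ 0) (h2 : y.1 2 ≠ 0) {ω : k} (hω : ω ^ (a * m) = 1)
    (h : ω ^ m = y.1 2 ^ m / y.1 1 ^ n) : boundaryPoint ω hω = Q := by
  have hω0 : ω ≠ 0 := by
    rintro rfl
    rw [zero_pow (mul_ne_zero (NeZero.ne a) (NeZero.ne m))] at hω
    exact zero_ne_one hω
  obtain ⟨t, ht1, ht2⟩ := exists_pow_eq_of_pow_eq_pow (Nat.pos_of_ne_zero (NeZero.ne m))
    (Nat.pos_of_ne_zero (NeZero.ne n)) hcop (div_ne_zero h2 hω0) h1 (by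
      rw [div_pow, h, div_div_cancel₀ (pow_ne_zero m h2)])
  refine Subtype.ext (Eq.trans ?_ hy)
  refine mk_eq_mk.mpr ⟨t, fun i => ?_⟩
  fin_cases i
  · simpa [boundaryVector] using h0
  · simpa [boundaryVector] using ht1.symm
  · change y.1 2 = (t : k) ^ n * ω
    rw [ht2, div_mul_cancel₀ _ hω0]

end FermatType

end

/-! ### The ramification divisor on `x₀ = 0` -/

theorem mainTheorem4 {k : Type*} [Field k] [IsAlgClosed k] [CharZero k] (a m n : ℕ)
    [NeZero a] [NeZero m] [NeZero n] (hmn : m < n) (hcop : Nat.Coprime m n) :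
    ∃ (γ : Fin a → k) (P : Fin a → FermatType.Curve k a m n),
      Function.Injective γ ∧ Set.range γ = {x : k | x ^ a = 1} ∧
      (∀ j, FermatType.HasLocalCoords (P j).1 (Pi.single (Fin.last m) (γ j))) ∧
      Function.Injective P ∧ Set.range P = FermatType.onLine k a m n ∧
      (∀ j, (∃ _ : IsDomain (FermatType.LocalRing (P j)),
          IsDiscreteValuationRing (FermatType.LocalRing (P j))) ∧
        FermatType.ramificationIndex (P j) = m ∧
        (2 ≤ m → FermatType.IsRamificationPoint (P j))) ∧
      (∀ Q : FermatType.Curve k a m n, FermatType.ramificationDivisorOnLine Q =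
        (((∑ j, Finsupp.single (P j) (m - 1)) Q : ℕ) : ℕ∞)) ∧
      ∑ᶠ Q : FermatType.Curve k a m n, FermatType.ramificationDivisorOnLine Q =
        ((a * (m - 1) : ℕ) : ℕ∞) := by
  classical
  have ha := NeZero.ne a
  have hm := NeZero.ne m
  have hN : a * m * n ≠ 0 := mul_ne_zero (mul_ne_zero ha hm) (NeZero.ne n)
  obtain ⟨ζ, hζ⟩ := HasEnoughRootsOfUnity.exists_primitiveRoot k a
  let γ : Fin a → k := fun j => ζ ^ (j : ℕ)
  have hγa (j : Fin a) : γ j ^ a = 1 := by rw [← pow_mul, mul_comm, pow_mul, hζ.pow_eq_one, one_pow]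
  have hγinj : Function.Injective γ := fun i j h => Fin.ext (hζ.pow_inj i.2 j.2 h)
  have hγrange : Set.range γ = {x : k | x ^ a = 1} := by
    ext x
    refine ⟨?_, fun hx => ?_⟩
    · rintro ⟨j, rfl⟩
      exact hγa j
    · obtain ⟨i, hi, h⟩ := hζ.eq_pow_of_pow_eq_one hx
      exact ⟨⟨i, hi⟩, h⟩
  -- Any `m`-th root will do: the point `[0, 1, ω]` depends only on `ω ^ m`.
  choose ω hω using fun j => IsAlgClosed.exists_pow_nat_eq (γ j) (Nat.pos_of_ne_zero hm)
  have hω1 (j : Fin a) : ω j ^ (a * m) = 1 := by rw [mul_comm, pow_mul, hω, hγa]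
  let P : Fin a → FermatType.Curve k a m n := fun j => FermatType.boundaryPoint (ω j) (hω1 j)
  have hcoords (j : Fin a) :
      FermatType.HasLocalCoords (P j).1 (Pi.single (Fin.last m) (γ j)) := by
    rw [← hω j]
    exact FermatType.hasLocalCoords_boundaryPoint (hω1 j) hcop
  have hPinj : Function.Injective P := by
    intro i j h
    -- The last local coordinate recovers `γ` from the point.
    have hi := (hcoords i _ rfl).2 (Fin.last m)
    have hj := (hcoords j _ (congrArg Subtype.val h)).2 (Fin.last m)
    rw [← hj, Pi.single_eq_same, Pi.single_eq_same] at hi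
    exact hγinj hi
  have hPrange : Set.range P = FermatType.onLine k a m n := by
    ext Q
    refine ⟨?_, fun hQ => ?_⟩
    · rintro ⟨j, rfl⟩
      exact FermatType.boundaryPoint_mem_onLine (hω1 j)
    · obtain ⟨y, hy, h0, h1, h2, heq⟩ := FermatType.exists_boundary_of_mem_onLine hQ
      have : y.1 2 ^ m / y.1 1 ^ n ∈ Set.range γ := by
        rw [hγrange]
        change (_ / _) ^ a = 1
        rw [div_pow, ← pow_mul, ← pow_mul, mul_comm m, mul_comm n, heq,
          div_self (pow_ne_zero _ h2)]
      obtain ⟨j, hj⟩ := this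
      exact ⟨j, FermatType.eq_boundaryPoint hcop hy h0 h1 h2 (hω1 j) ((hω j).trans hj)⟩
  have hlocal (j : Fin a) : (∃ _ : IsDomain (FermatType.LocalRing (P j)),
      IsDiscreteValuationRing (FermatType.LocalRing (P j))) ∧
      FermatType.ramificationIndex (P j) = m ∧
      FermatType.ramificationDivisor (P j) = (m - 1 : ℕ) := by
    obtain ⟨c, s, w, t, θ, h⟩ := FermatType.exists_chart hcop (P j)
      (x := FermatType.boundaryVector (ω j)) rfl rfl rfl
    have := h.isDomain ha hm hN
    exact ⟨⟨this, h.isDiscreteValuationRing ha hm hN⟩, h.ramificationIdx_eq ha hm hN,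
      h.length_eq ha hm hN⟩
  have hsum (j : Fin a) : (∑ i, Finsupp.single (P i) (m - 1)) (P j) = m - 1 := by
    rw [Finsupp.finsetSum_apply, Finset.sum_eq_single j]
    · exact Finsupp.single_eq_same
    · intro i _ hij
      exact Finsupp.single_eq_of_ne fun h => hij (hPinj h.symm)
    · simp
  have hon (j : Fin a) : FermatType.ramificationDivisorOnLine (P j) = (m - 1 : ℕ) := by
    rw [FermatType.ramificationDivisorOnLine, Set.indicator_of_mem (hPrange ▸ Set.mem_range_self j)]
    exact (hlocal j).2.2
  refine ⟨γ, P, hγinj, hγrange, hcoords, hPinj, hPrange,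
    fun j => ⟨(hlocal j).1, (hlocal j).2.1, fun h => ?_⟩, fun Q => ?_, ?_⟩
  · rw [FermatType.IsRamificationPoint, (hlocal j).2.1]
    omega
  · by_cases hQ : Q ∈ Set.range P
    · obtain ⟨j, rfl⟩ := hQ
      rw [hsum, hon]
    · rw [FermatType.ramificationDivisorOnLine, Set.indicator_of_notMem (hPrange ▸ hQ),
        Finsupp.finsetSum_apply, Finset.sum_eq_zero, Nat.cast_zero]
      intro i _
      exact Finsupp.single_eq_of_ne fun h => hQ ⟨i, h.symm⟩
  · rw [finsum_eq_sum_of_support_subset (s := Finset.univ.image P),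
      Finset.sum_image hPinj.injOn, Finset.sum_congr rfl fun j _ => hon j]
    · simp
    · rw [Finset.coe_image, Finset.coe_univ, Set.image_univ, hPrange]
      exact Set.support_indicator_subset
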